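/- **Conventions.** $\mathbb N=\{1,2,\dots\}$, $c_{00}=c_{00}(\mathbb N)$ is the space of finitely supported real sequences with unit vectors $e_n$, and $f(x)=\sum_k f(k)x(k)$. Write $f<g$ if every element of $\operatorname{supp}f$ is smaller than every element of $\operatorname{supp}g$. A finite sequence is successive if $f_1<f_2<\cdots$ (pairwise), and block if moreover all terms are nonzero. For an interval $E$, $Ef=f\cdot 1_E$; $f|_{ev}$ is the restriction of $f$ to the even integers; $\hat g(2n)=g(n)$, $\hat g(2n-1)=0$. $\operatorname{conv}_{\mathbb Q}$ denotes finite convex combinations with rational coefficients. Let $m_0=2$, $m_{j+1}=m_j^5$, $n_0=4$, $n_{j+1}=(12n_j)^{s_j}$ with $2^{s_j}\ge m_{j+1}^3$. The $(\mathcal A_N,m_j^{-1})$-operation sends a successive sequence $(f_i)_{i=1}^k$, $1\le k\le N$, to $m_j^{-1}\sum_{i\le k}f_i$. An element $f$ of $c_{00}$ has weight $w(f)=m_j$ in a set $W$ if it is the result of an $(\mathcal A_{n_j},m_j^{-1})$-operation on elements of $W$. **Mixed Tsirelson set, EO-completeness.** Put $N_j=n_j$ for even $j$ and $N_j=2n_j$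 for odd $j$. Let $W_{mT}$ be the smallest subset of $c_{00}$ that contains $\pm e_n$ ($n\in\mathbb N$), is closed under the $(\mathcal A_{N_j},m_j^{-1})$-operations ($j\ge 0$), is symmetric and closed under restrictions to intervals, and is closed under rational convex combinations. A set $W\subset W_{mT}$ is EO-complete if it contains all $\pm e_n$, is closed under the $(\mathcal A_{n_{2j}},m_{2j}^{-1})$-operations ($j\ge0$), is symmetric and closed under restrictions to intervals, and every $f\in W$ has a tree analysis with all nodes in $W$: a finite tree of elements of $W$ with root $f$, whose leaves are of the form $\pm e_n$, and in which every other node is either the result of an $(\mathcal A_{N_j},m_j^{-1})$-operation on its immediate successors, for some $j$, or a rational convex combination of them. **The set $W_{hi}$.** Fix disjoint infinite sets $\Omega_1,\Omega_2$ of non-negative integers. Let $\mathbb Q_s$ be the set of nonempty finite block sequences of vectors with rational coordinates, and fix an injective $\sigma:\mathbb Q_s\to\{2j:j\in\Omega_2\}$ with $m_{\sigma(f_1,\dots,f_l)}>\max\{|f_i(k)|^{-1}:k\in\operatorname{supp}f_i,\ i\le l\}\cdot\max\operatorname{supp}f_l$. For $j\ge1$, a $(2j-1)$-special sequence of $W$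 is a sequence $(f_1,\dots,f_k)\in\mathbb Q_s$ of elements of $W$ with $k\le n_{2j-1}$, $w(f_1)=m_{2j_1}\ge n_{2j-1}^2$ for some $j_1\in\Omega_1$, and $w(f_{i+1})=m_{\sigma(f_1,\dots,f_i)}$ for $1\le i<k$ (weights in $W$); the empty sequence is also counted as special. $W_{hi}$ is the smallest set $W\subset c_{00}$ that contains all $\pm e_n$, is closed under the $(\mathcal A_{n_{2j}},m_{2j}^{-1})$-operations ($j\ge0$), contains $m_{2j-1}^{-1}\sum_i f_i$ for every $(2j-1)$-special sequence $(f_i)$ of $W$ ($j\ge 1$), is symmetric, closed under restrictions to intervals, and closed under rational convex combinations. **The sets $K$ and special sequences.** Let $K^{2j}=\{m_{2j}^{-1}\sum_{i\in F}e_i:\#F=n_{2j}\}$ ($j\ge0$), and for each $j$ fix pairwise disjoint $K_k^{2j}\subset K^{2j}$ ($k\ge1$), each of which contains elements whose supports have arbitrarily large minimum; $\widehat{K}_k^{2j}=\{\hat f:f\in K_k^{2j}\}$. Let $n,j\ge1$, let $V\subset c_{00}$, and let maps $\varrho_k^{2i}:L_k^{2i}\to K_k^{2i}$ ($1\le k\le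 n$, $i\ge0$) be given. * A *paired* $(2j-1)$-special sequence is a block sequence $(f_1,\hat g_1,\dots,f_p,\hat g_p)$, $p\le n_{2j-1}$, such that for each $k$ there are $i_k\le n$, $j_k\ge0$ with $f_k\in V\cap L_{i_k}^{2j_k}$ and $g_k=\varrho_{i_k}^{2j_k}(f_k)$, and $(g_1,\dots,g_p)$ is a $(2j-1)$-special sequence of $W_{hi}$. * A *semi paired* one is a block sequence $(f_1,\hat g_1,\dots,f_l,\hat g_l,\hat g_{l+1},\dots,\hat g_p)$, $0\le l\le p\le n_{2j-1}$, such that $(f_i,\hat g_i)_{i\le l}$ is paired; for each $r>l$ one has $g_r\in K_{i_r}^{2j_r}$ for some $i_r\le n$, $j_r\ge0$; $(g_1,\dots,g_p)$ is a $(2j-1)$-special sequence of $W_{hi}$; and, if $l<p$, there is no $\phi\in V$ for which $(f_1,\hat g_1,\dots,f_l,\hat g_l,\phi,\hat g_{l+1})$ is paired with $g_{l+1}$ as partner of $\phi$. * A *special* one is a block sequence $(f_1,\hat g_1,\dots,f_l,\hat g_l,\hat g_{l+1},\dots,\hat g_m,h_{m+1},\dots,h_p)$, $0\le l\le m\le p\le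 n_{2j-1}$, whose part without the $h$'s is semi paired, with $h_r\in V$ for all $r>m$, $h_{m+1}|_{ev}\notin\bigcup_{i\ge0}\bigcup_{k=1}^n\widehat K_k^{2i}$ (if $m<p$), and $h_r|_{ev}=\hat\phi_r$ for $r>m$, where $(g_1,\dots,g_m,\phi_{m+1},\dots,\phi_p)$ is a $(2j-1)$-special sequence of $W_{hi}$. **The set $W_{ex}$ and the space $X_{ex}$.** Let $W_0=\{\pm e_n:n\in\mathbb N\}$. For $n\ge1$ let $U_n$ be the set of results of all $(\mathcal A_{n_{2j}},m_{2j}^{-1})$-operations, $j\ge0$, on elements of $W_{n-1}$; put $$V_n=\Bigl(U_n\setminus\bigcup_{j\ge0}\bigcup_{i>n}\widehat K_i^{2j}\Bigr)\cup W_{n-1},\qquad D_n=V_n\setminus W_{n-1},$$ let $L_n^{2i}$ be the set of $f\in D_n$ with $w(f)=m_{2i}$ (in $W_{n-1}$) and $\operatorname{supp}f\subset\{1,3,5,\dots\}$, choose arbitrary injections $\varrho_n^{2i}:L_n^{2i}\to K_n^{2i}$ ($i\ge 0$) with $f<\widehat{\varrho_n^{2i}(f)}$ for all $f\in L_n^{2i}$,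 let $W_n^{2j-1}$ be the set of all vectors $m_{2j-1}^{-1}\bigl(\sum_{i\le l}(f_i+\hat g_i)+\sum_{l<i\le m}\hat g_i+\sum_{m<i\le p}h_i\bigr)$ given by special $(2j-1)$-sequences for $V=V_n$ and $(\varrho_k^{2i})_{k\le n,\,i\ge0}$, and put $$W_n=\operatorname{conv}_{\mathbb Q}\Bigl\{\pm Ef:\ f\in V_n\cup\bigcup_{j\ge1}W_n^{2j-1},\ E\text{ an interval of }\mathbb N\Bigr\}.$$ Let $W_{ex}=\bigcup_{n\ge0}W_n$, and let $X_{ex}$ be the completion of $c_{00}$ under $\|x\|=\sup\{f(x):f\in W_{ex}\}$. **Proposition.** For every choice of the data above: $W_{ex}$ is an EO-complete subset of $W_{mT}$ and is closed under rational convex combinations; $\|x\|=\sup\{f(x):f\in W_{ex}\}$ is finite for all $x\in c_{00}$ and is a seminorm on $c_{00}$ (a norm, as $\pm e_n\in W_{ex}$); the space $X_{ex}$ is reflexive; and $B_{X_{ex}^*}=\overline{W_{ex}}^{\|\cdot\|}$, where $B_{X_{ex}^*}$ is the closed unit ball of the dual and every $f\in W_{ex}$ is identified with the continuous extension of $x\mapsto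 f(x)$ to $X_{ex}$. -/

import Mathlib

open scoped BigOperators

/-! ## Finitely supported sequences indexed by the positive integers -/

/-- The space `c₀₀(ℕ)` of finitely supported real sequences `(x(1), x(2), …)`. -/
abbrev C00 : Type := ℕ+ →₀ ℝ

namespace Ex

/-- `f < g`: the supports are successive. -/
def Before (f g : C00) : Prop := ∀ a ∈ f.support, ∀ b ∈ g.support, a < b

/-- `supp f₁ < supp f₂ < ⋯ < supp f_k`. -/
def Successive {k : ℕ} (f : Fin k → C00) : Prop := ∀ i j : Fin k, i < j → Before (f i) (f j)

/-- A finite block sequence: nonzero terms with successive supports. -/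
def IsBlockList (L : List C00) : Prop := (∀ f ∈ L, f ≠ 0) ∧ L.Pairwise Before

/-- The restriction of `f` to the interval `{a, …, b}` (empty if `b < a`). -/
noncomputable def restrict (a b : ℕ+) (f : C00) : C00 := f.filter (fun k => a ≤ k ∧ k ≤ b)

/-- The restriction of `f` to the even positive integers. -/
noncomputable def evenPart (f : C00) : C00 := f.filter (fun k => Even (k : ℕ))

/-- `ĝ(2n) = g(n)` and `ĝ(2n-1) = 0`. -/
noncomputable def hat (g : C00) : C00 := g.mapDomain (fun k => 2 * k)

/-- The rational convex hull: finite convex combinations with rational coefficients. -/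
def ratConv (S : Set C00) : Set C00 :=
  {f | ∃ (k : ℕ) (r : Fin k → ℚ) (g : Fin k → C00),
    (∀ i, 0 ≤ r i) ∧ ∑ i, r i = 1 ∧ (∀ i, g i ∈ S) ∧ f = ∑ i, (r i : ℝ) • g i}

/-- `S` is closed under rational convex combinations. -/
def RatConvex (S : Set C00) : Prop := ratConv S ⊆ S

/-- The vectors `± e_n`. -/
def signedBasis : Set C00 :=
  {f | ∃ n : ℕ+, f = Finsupp.single n 1 ∨ f = -Finsupp.single n 1}

/-! ## The parameters `m_j`, `n_j` and the operations -/

/-- `m₀ = 2`, `m_{j+1} = m_j ^ 5`. -/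
def mSeq : ℕ → ℕ
  | 0 => 2
  | j + 1 => mSeq j ^ 5

/-- `n₀ = 4`, `n_{j+1} = (12 n_j) ^ s_j`. -/
def nSeq (s : ℕ → ℕ) : ℕ → ℕ
  | 0 => 4
  | j + 1 => (12 * nSeq s j) ^ s j

/-- The results of the operation `(𝒜_N, m_j⁻¹)` on elements of `W`: all vectors
`m_j⁻¹ (f₁ + ⋯ + f_k)`, where `1 ≤ k ≤ N`, `f_i ∈ W` and `supp f₁ < ⋯ < supp f_k`. -/
def opResults (W : Set C00) (N j : ℕ) : Set C00 :=
  {f | ∃ (k : ℕ) (g : Fin k → C00), 1 ≤ k ∧ k ≤ N ∧ (∀ i, g i ∈ W) ∧ Successive g ∧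
    f = ((mSeq j : ℝ)⁻¹) • ∑ i, g i}

/-- Symmetric and closed under restrictions to intervals. -/
def SymmInterval (W : Set C00) : Prop :=
  (∀ f ∈ W, -f ∈ W) ∧ ∀ f ∈ W, ∀ a b : ℕ+, restrict a b f ∈ W

/-! ## Mixed Tsirelson norming sets, tree analyses, EO-complete sets -/

/-- The norming set of `T[(𝒜_{N_j}, m_j⁻¹)_j]`, i.e. the smallest subset of `c₀₀(ℕ)` that contains
`± e_n`, is closed under the operations `(𝒜_{N_j}, m_j⁻¹)`, is symmetric and closed under
restrictions to intervals, and is closed under rational convex combinations. -/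
def WmT (N : ℕ → ℕ) : Set C00 :=
  ⋂₀ {W | signedBasis ⊆ W ∧ (∀ j, opResults W (N j) j ⊆ W) ∧ SymmInterval W ∧ RatConvex W}

/-- `HasTreeAnalysis N W f`: the vector `f` has a tree analysis (for the operations
`(𝒜_{N_j}, m_j⁻¹)`) all of whose nodes are in `W`. The (finite) derivation tree is the tree: the
leaves are `± e_n`, and every other node is either the result of an operation on its immediate
successors or a rational convex combination of them. -/
inductive HasTreeAnalysis (N : ℕ → ℕ) (W : Set C00) : C00 → Prop
  | leaf (f : C00) (hW : f ∈ W) (hf : f ∈ signedBasis) : HasTreeAnalysis N W f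
  | op (f : C00) (hW : f ∈ W) (j k : ℕ) (g : Fin k → C00) (hk : 1 ≤ k) (hkN : k ≤ N j)
      (hg : Successive g) (hf : f = ((mSeq j : ℝ)⁻¹) • ∑ i, g i)
      (sub : ∀ i, HasTreeAnalysis N W (g i)) : HasTreeAnalysis N W f
  | conv (f : C00) (hW : f ∈ W) (k : ℕ) (r : Fin k → ℚ) (g : Fin k → C00) (hr : ∀ i, 0 ≤ r i)
      (hr1 : ∑ i, r i = 1) (hf : f = ∑ i, (r i : ℝ) • g i)
      (sub : ∀ i, HasTreeAnalysis N W (g i)) : HasTreeAnalysis N W f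

/-- `W` is an even operation complete subset of the mixed Tsirelson norming set `WmT N`. -/
structure EOComplete (N : ℕ → ℕ) (W : Set C00) : Prop where
  subset : W ⊆ WmT N
  basis : signedBasis ⊆ W
  even_op : ∀ j, opResults W (N (2 * j)) (2 * j) ⊆ W
  symmInterval : SymmInterval W
  tree : ∀ f ∈ W, HasTreeAnalysis N W f

/-- The lengths used for the extended space: `n_j` for even `j` and `2 n_j` for odd `j`. -/
def nExt (s : ℕ → ℕ) (j : ℕ) : ℕ := if Even j then nSeq s j else 2 * nSeq s j

/-! ## Special sequences and the norming set `W_hi` -/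

/-- The set `ℚ_s` of nonempty finite block sequences with rational coordinates. -/
def Qs : Set (List C00) :=
  {L | L ≠ [] ∧ IsBlockList L ∧ ∀ f ∈ L, ∀ k, ∃ q : ℚ, f k = q}

/-- `σ` is a coding function: it is injective on `ℚ_s`, takes values in `{2j : j ∈ Ω₂}` and
`m_{σ(f₁,…,f_l)} > max {1 / |f_i(k)| : k ∈ supp f_i, i ≤ l} · max supp f_l`. -/
structure IsCoding (Ω₂ : Set ℕ) (σ : List C00 → ℕ) : Prop where
  injOn : Set.InjOn σ Qs
  mem : ∀ L ∈ Qs, ∃ j ∈ Ω₂, σ L = 2 * j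
  growth : ∀ L ∈ Qs, ∀ f ∈ L, ∀ k ∈ f.support, ∀ g ∈ L.getLast?, ∀ a ∈ g.support,
    1 / |f k| * ((a : ℕ) : ℝ) < (mSeq (σ L) : ℝ)

/-- `f` is weighted in `W`, with weight `w(f) = m_j`: it is the result of an
`(𝒜_{n_j}, m_j⁻¹)`-operation on elements of `W`. -/
def HasWeight (s : ℕ → ℕ) (W : Set C00) (j : ℕ) (f : C00) : Prop := f ∈ opResults W (nSeq s j) j

/-- `(f₁, …, f_k)` is a `(2j-1)`-special sequence of `W`. The odd number `2j-1`, for a positive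
integer `j`, is written `2j+1` with `j : ℕ` here and below. The empty list counts as special. -/
def IsSpecialSeq (s : ℕ → ℕ) (Ω₁ : Set ℕ) (σ : List C00 → ℕ) (W : Set C00) (j : ℕ)
    (L : List C00) : Prop :=
  (L ≠ [] → L ∈ Qs) ∧ L.length ≤ nSeq s (2 * j + 1) ∧ (∀ f ∈ L, f ∈ W) ∧
  (∀ f ∈ L.head?, ∃ i ∈ Ω₁, HasWeight s W (2 * i) f ∧
    nSeq s (2 * j + 1) ^ 2 ≤ mSeq (2 * i)) ∧
  (∀ (i : ℕ) (hi : i + 1 < L.length), HasWeight s W (σ (L.take (i + 1))) L[i + 1])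

/-- The norming set `W_hi`: the smallest set that contains `± e_n`, is closed under the even
operations and under the odd operations on its special sequences, is symmetric and closed under
restrictions to intervals, and is closed under rational convex combinations. -/
def Whi (s : ℕ → ℕ) (Ω₁ : Set ℕ) (σ : List C00 → ℕ) : Set C00 :=
  ⋂₀ {W | signedBasis ⊆ W ∧ (∀ j, opResults W (nSeq s (2 * j)) (2 * j) ⊆ W) ∧
    (∀ j L, IsSpecialSeq s Ω₁ σ W j L → ((mSeq (2 * j + 1) : ℝ)⁻¹) • L.sum ∈ W) ∧
    SymmInterval W ∧ RatConvex W}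

/-! ## The sets `K` and the three kinds of special sequences of the extended space -/

/-- `K^{2j} = {m_{2j}⁻¹ ∑_{i ∈ F} e_i : #F = n_{2j}}`. -/
def Kfull (s : ℕ → ℕ) (j : ℕ) : Set C00 :=
  {f | ∃ F : Finset ℕ+, F.card = nSeq s (2 * j) ∧
    f = ((mSeq (2 * j) : ℝ)⁻¹) • ∑ i ∈ F, Finsupp.single i (1 : ℝ)}

/-- `K k j`, for `k ≥ 1`, stands for `K_k^{2j}`: these are disjoint subsets of `K^{2j}`, each of
which contains elements with arbitrarily large minimum of the support. -/
structure IsKFamily (s : ℕ → ℕ) (K : ℕ → ℕ → Set C00) : Prop where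
  subset : ∀ k j, 1 ≤ k → K k j ⊆ Kfull s j
  disjoint : ∀ k l j, 1 ≤ k → 1 ≤ l → k ≠ l → Disjoint (K k j) (K l j)
  unbounded : ∀ k j, 1 ≤ k → ∀ M : ℕ+, ∃ f ∈ K k j, ∀ a ∈ f.support, M ≤ a

/-- The fixed data of the construction: `s` (hence the `n_j`), `Ω₁`, the coding `σ`, the sets
`K k j = K_k^{2j}` and the functions `ρ k j = ϱ_k^{2j}`. -/
structure Data where
  s : ℕ → ℕ
  Ω₁ : Set ℕ
  σ : List C00 → ℕ
  K : ℕ → ℕ → Set C00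
  ρ : ℕ → ℕ → C00 → C00

/-- The special sequences of `W_hi`. -/
def HiSpecial (D : Data) (j : ℕ) (L : List C00) : Prop :=
  IsSpecialSeq D.s D.Ω₁ D.σ (Whi D.s D.Ω₁ D.σ) j L

/-- `(f₁, ĝ₁, …, f_l, ĝ_l)` from `((f₁, g₁), …, (f_l, g_l))`. -/
noncomputable def flat (P : List (C00 × C00)) : List C00 := P.flatMap (fun p => [p.1, hat p.2])

/-- `(f₁, ĝ₁, …, f_p, ĝ_p)` is a `(2j-1, V, (ϱ_k^{2i})_{k ≤ n}, i ≥ 0)`-paired special sequence,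
where `L k i` stands for `L_k^{2i}`. -/
def IsPaired (D : Data) (j n : ℕ) (V : Set C00) (L : ℕ → ℕ → Set C00)
    (P : List (C00 × C00)) : Prop :=
  IsBlockList (flat P) ∧ P.length ≤ nSeq D.s (2 * j + 1) ∧
  (∀ p ∈ P, ∃ k i, 1 ≤ k ∧ k ≤ n ∧ p.1 ∈ V ∩ L k i ∧ p.2 = D.ρ k i p.1) ∧
  HiSpecial D j (P.map Prod.snd)

/-- `(f₁, ĝ₁, …, f_l, ĝ_l, ĝ_{l+1}, …, ĝ_p)`, with `P = ((f_i, g_i))_{i ≤ l}` and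
`G = (g_{l+1}, …, g_p)`, is a semi paired special sequence. -/
def IsSemiPaired (D : Data) (j n : ℕ) (V : Set C00) (L : ℕ → ℕ → Set C00)
    (P : List (C00 × C00)) (G : List C00) : Prop :=
  IsBlockList (flat P ++ G.map hat) ∧ P.length + G.length ≤ nSeq D.s (2 * j + 1) ∧
  IsPaired D j n V L P ∧
  (∀ g ∈ G, ∃ k i, 1 ≤ k ∧ k ≤ n ∧ g ∈ D.K k i) ∧
  HiSpecial D j (P.map Prod.snd ++ G) ∧
  (∀ g ∈ G.head?, ¬ ∃ φ ∈ V, IsPaired D j n V L (P ++ [(φ, g)]))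

/-- `(f₁, ĝ₁, …, f_l, ĝ_l, ĝ_{l+1}, …, ĝ_m, h_{m+1}, …, h_p)`, with `P = ((f_i, g_i))_{i ≤ l}`,
`G = (g_{l+1}, …, g_m)` and `H = (h_{m+1}, …, h_p)`, is a special sequence. -/
def IsExSpecial (D : Data) (j n : ℕ) (V : Set C00) (L : ℕ → ℕ → Set C00)
    (P : List (C00 × C00)) (G H : List C00) : Prop :=
  IsBlockList (flat P ++ G.map hat ++ H) ∧
  P.length + G.length + H.length ≤ nSeq D.s (2 * j + 1) ∧
  IsSemiPaired D j n V L P G ∧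
  (∀ h ∈ H, h ∈ V) ∧
  (∀ h ∈ H.head?, ∀ k i, 1 ≤ k → k ≤ n → evenPart h ∉ hat '' D.K k i) ∧
  (∃ Φ : List C00, H.map evenPart = Φ.map hat ∧ HiSpecial D j (P.map Prod.snd ++ G ++ Φ))

/-! ## The norming set `W_ex` -/

/-- `U_n`, from `W = W_{n-1}`: the results of the even operations on `W_{n-1}`. -/
def Uset (D : Data) (W : Set C00) : Set C00 := ⋃ j, opResults W (nSeq D.s (2 * j)) (2 * j)

/-- `V_n = (U_n ∖ ⋃_j ⋃_{i > n} K̂_i^{2j}) ∪ W_{n-1}`, from `W = W_{n-1}`. -/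
def Vset (D : Data) (n : ℕ) (W : Set C00) : Set C00 :=
  (Uset D W \ ⋃ j, ⋃ i, ⋃ (_ : n < i), hat '' D.K i j) ∪ W

/-- `L_n^{2i} = {f ∈ D_n : w(f) = m_{2i}, supp f ⊆ {1, 3, 5, …}}`, where `D_n = V_n ∖ W_{n-1}`,
from `W = W_{n-1}`. -/
def Lset (D : Data) (n : ℕ) (W : Set C00) (i : ℕ) : Set C00 :=
  {f | f ∈ Vset D n W \ W ∧ HasWeight D.s W (2 * i) f ∧ ∀ k ∈ f.support, Odd (k : ℕ)}

/-- `W_n^{2j-1}`: the functionals defined by the special sequences of the extended space. -/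
def specialFunctionals (D : Data) (j n : ℕ) (V : Set C00) (L : ℕ → ℕ → Set C00) : Set C00 :=
  {f | ∃ P G H, IsExSpecial D j n V L P G H ∧
    f = ((mSeq (2 * j + 1) : ℝ)⁻¹) • (flat P ++ G.map hat ++ H).sum}

/-- `conv_ℚ {± E f : f ∈ S, E an interval}`. -/
def symmIntervalHull (S : Set C00) : Set C00 :=
  ratConv {g | ∃ f ∈ S, ∃ a b : ℕ+, g = restrict a b f ∨ g = -restrict a b f}

/-- The pair `(W_n, (L_k^{2i})_{k, i})`, where only the sets with `1 ≤ k ≤ n` have been defined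
(the others are empty). -/
noncomputable def stage (D : Data) : ℕ → Set C00 × (ℕ → ℕ → Set C00)
  | 0 => (signedBasis, fun _ _ => ∅)
  | n + 1 =>
    let W := (stage D n).1
    let V := Vset D (n + 1) W
    let L := Function.update (stage D n).2 (n + 1) (Lset D (n + 1) W)
    (symmIntervalHull (V ∪ ⋃ j, specialFunctionals D j (n + 1) V L), L)

/-- `W_n`. -/
noncomputable def Wlevel (D : Data) (n : ℕ) : Set C00 := (stage D n).1

/-- `L_n^{2i}`, for `n ≥ 1`. -/
noncomputable def Llevel (D : Data) (n i : ℕ) : Set C00 := Lset D n (Wlevel D (n - 1)) i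

/-- `W_ex = ⋃_n W_n`. -/
noncomputable def Wex (D : Data) : Set C00 := ⋃ n, Wlevel D n

/-- The standing assumptions on the fixed data. The conditions `ρ_mem`, `ρ_inj`, `ρ_before` say that
`ϱ_n^{2i} : L_n^{2i} → K_n^{2i}` is an injection and that `f` precedes the image of `ϱ_n^{2i}(f)` under `hat`. -/
structure Data.Admissible (D : Data) (Ω₂ : Set ℕ) : Prop where
  s_large : ∀ j, mSeq (j + 1) ^ 3 ≤ 2 ^ D.s j
  Ω₁_infinite : D.Ω₁.Infinite
  Ω₂_infinite : Ω₂.Infinite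
  Ω_disjoint : Disjoint D.Ω₁ Ω₂
  coding : IsCoding Ω₂ D.σ
  family : IsKFamily D.s D.K
  ρ_mem : ∀ n i, 1 ≤ n → ∀ f ∈ Llevel D n i, D.ρ n i f ∈ D.K n i
  ρ_inj : ∀ n i, 1 ≤ n → Set.InjOn (D.ρ n i) (Llevel D n i)
  ρ_before : ∀ n i, 1 ≤ n → ∀ f ∈ Llevel D n i, Before f (hat (D.ρ n i f))

theorem stage_snd (D : Data) (n k i : ℕ) :
    (stage D n).2 k i = {f | 1 ≤ k ∧ k ≤ n ∧ f ∈ Llevel D k i} := by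
  induction n with
  | zero =>
    have h : ¬ (1 ≤ k ∧ k ≤ 0) := by omega
    ext f
    simp only [stage, Set.mem_empty_iff_false, Set.mem_ofPred_eq, false_iff]
    exact fun hh => h ⟨hh.1, hh.2.1⟩
  | succ n ih =>
    by_cases hk : k = n + 1
    · subst hk
      ext f
      simp [stage, Llevel, Wlevel]
    · have h1 : (stage D (n + 1)).2 k i = (stage D n).2 k i := by
        simp [stage, Function.update_of_ne hk]
      rw [h1, ih]
      ext f
      simp only [Set.mem_ofPred_eq]
      constructor
      · rintro ⟨a, b, c⟩
        exact ⟨a, by omega, c⟩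
      · rintro ⟨a, b, c⟩
        exact ⟨a, by omega, c⟩

theorem Wlevel_zero (D : Data) : Wlevel D 0 = signedBasis := rfl

theorem Wlevel_succ (D : Data) (n : ℕ) :
    Wlevel D (n + 1) = symmIntervalHull (Vset D (n + 1) (Wlevel D n) ∪
      ⋃ j, specialFunctionals D j (n + 1) (Vset D (n + 1) (Wlevel D n))
        (fun k i => {f | 1 ≤ k ∧ k ≤ n + 1 ∧ f ∈ Llevel D k i})) := by
  have h : (stage D (n + 1)).2 = fun k i => {f | 1 ≤ k ∧ k ≤ n + 1 ∧ f ∈ Llevel D k i} := by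
    funext k i
    exact stage_snd D (n + 1) k i
  rw [← h]
  rfl

/-! ## The Banach space induced by a norming set -/

/-- The linear functional `x ↦ ∑_k f(k) x(k)` on `c₀₀(ℕ)`. -/
noncomputable def act (f : C00) : C00 →ₗ[ℝ] ℝ := Finsupp.linearCombination ℝ (fun k => f k)

/-- The seminorm `x ↦ sup {|f(x)| : f ∈ W}` on `c₀₀(ℕ)`, for a pointwise bounded set `W`. -/
noncomputable def normOf (W : Set C00) : Seminorm ℝ C00 :=
  ⨆ f : W, (normSeminorm ℝ ℝ).comp (act (f : C00))

/-- For a nonempty, symmetric and pointwise bounded `W` this is `x ↦ sup {f(x) : f ∈ W}`. -/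
theorem isLUB_normOf (W : Set C00) (hne : W.Nonempty) (hsymm : ∀ f ∈ W, -f ∈ W)
    (hbdd : ∀ x : C00, BddAbove ((fun f => act f x) '' W)) (x : C00) :
    IsLUB ((fun f => act f x) '' W) (normOf W x) := by
  have hneg : ∀ (f x : C00), act (-f) x = -act f x := by
    intro f x
    simp [act, Finsupp.linearCombination_apply, Finsupp.sum]
  have habs : ∀ y : C00, ∀ c, c ∈ upperBounds ((fun f => act f y) '' W) →
      ∀ f ∈ W, |act f y| ≤ c := by
    intro y c hc f hf
    refine abs_le.2 ⟨?_, hc ⟨f, hf, rfl⟩⟩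
    have := hc ⟨-f, hsymm f hf, rfl⟩
    simp only [hneg] at this
    linarith
  have hb : BddAbove (Set.range fun f : W => (normSeminorm ℝ ℝ).comp (act (f : C00))) := by
    rw [Seminorm.bddAbove_range_iff]
    intro y
    obtain ⟨c, hc⟩ := hbdd y
    refine ⟨c, ?_⟩
    rintro _ ⟨f, rfl⟩
    exact habs y c hc f f.2
  have hval : normOf W x = ⨆ f : W, |act (f : C00) x| := by
    rw [normOf, Seminorm.iSup_apply hb]
    rfl
  have : Nonempty W := hne.to_subtype
  rw [hval]
  constructor
  · rintro _ ⟨f, hf, rfl⟩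
    obtain ⟨c, hc⟩ := hbdd x
    refine (le_abs_self _).trans (le_ciSup (f := fun f : W => |act (f : C00) x|) ?_ ⟨f, hf⟩)
    refine ⟨c, ?_⟩
    rintro _ ⟨g, rfl⟩
    exact habs x c hc g g.2
  · intro c hc
    exact ciSup_le fun f => habs x c hc f f.2

/-- `c₀₀(ℕ)` with the norm induced by `W`. -/
def Pre (_W : Set C00) : Type := C00

noncomputable instance (W : Set C00) : AddCommGroup (Pre W) := inferInstanceAs (AddCommGroup C00)

noncomputable instance (W : Set C00) : Module ℝ (Pre W) := inferInstanceAs (Module ℝ C00)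

noncomputable instance (W : Set C00) : SeminormedAddCommGroup (Pre W) :=
  AddGroupSeminorm.toSeminormedAddCommGroup (E := Pre W) (normOf W).toAddGroupSeminorm

noncomputable instance (W : Set C00) : NormedSpace ℝ (Pre W) where
  norm_smul_le a x := le_of_eq (map_smul_eq_mul (normOf W) a x)

/-- The completion `X_W` of `c₀₀(ℕ)` under the norm induced by `W`. -/
abbrev Space (W : Set C00) : Type := UniformSpace.Completion (Pre W)

/-- The canonical map of `c₀₀(ℕ)` to `X_W`. -/
noncomputable def toSpace (W : Set C00) (x : C00) : Space W :=
  UniformSpace.Completion.coe' (show Pre W from x)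

theorem norm_toSpace (W : Set C00) (x : C00) : ‖toSpace W x‖ = normOf W x :=
  UniformSpace.Completion.norm_coe _

/-- `W` as a subset of the dual of `X_W`: the functionals that extend `x ↦ f(x)` for some
`f ∈ W`. -/
def asFunctionals (W : Set C00) : Set (StrongDual ℝ (Space W)) :=
  {φ | ∃ f ∈ W, ∀ x : C00, φ (toSpace W x) = act f x}

/-- Reflexivity of a normed space: the canonical embedding into the bidual is onto. -/
def Reflexive (X : Type) [NormedAddCommGroup X] [NormedSpace ℝ X] : Prop :=
  Function.Surjective (NormedSpace.inclusionInDoubleDual ℝ X)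

end Ex

namespace Ex

/-! ## Restrictions and successive sequences -/

/-! Membership in `Wex` is combinatorial; reflexivity and the description of the dual ball then hold
for every EO-complete, rationally convex set `W` whose even parameters satisfy `m² ≤ N`.

For `Wex`, the delicate point is closure under even operations, since `Vset` withholds certain
vectors of K̂. The sets `K k j` are disjoint, so a withheld vector has a single index `k` and is
admitted at level `k` (`opResults_even_subset_Wex`). Trees are built by induction on the level
(`hasTreeAnalysis_Wex`). A special functional is one odd operation; each pair (f, ĝ) occupies two
places, whence the doubled odd lengths.

For general `W`, let x be in the unit ball. A functional of small weight is small on a long average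
of successive vectors following x, and one of large weight is small on x, so half the sum of x and
such an average has norm at most 7/8 (`normOf_half_add_average_le`). A bounded functional therefore
has tails tending to 0 in norm: the basis is shrinking and c₀₀ is dense in the dual
(`denseRange_toDual`). On the other side, even operations turn many remote elements of `W` into one
element on which a bounded form would be too large (`exists_remote_bound`), so the partial sums with
coefficients F(e_k*) of a bidual element F converge; the limit represents F (`reflexive`).

By reflexivity, a functional on the dual that separates a point from the norm closure of `W` is
evaluation at some x in the space. As `W` norms x, no point of the dual ball can be separated in
this way. -/

theorem restrict_apply (a b : ℕ+) (f : C00) (k : ℕ+) :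
    restrict a b f k = if a ≤ k ∧ k ≤ b then f k else 0 := by
  simp [restrict, Finsupp.filter_apply]

theorem restrict_neg (a b : ℕ+) (f : C00) : restrict a b (-f) = -restrict a b f := by
  ext k; simp only [restrict_apply, Finsupp.neg_apply]; split_ifs <;> simp

theorem restrict_smul (a b : ℕ+) (c : ℝ) (f : C00) :
    restrict a b (c • f) = c • restrict a b f := by
  ext k; simp [restrict_apply]

theorem restrict_add (a b : ℕ+) (f g : C00) :
    restrict a b (f + g) = restrict a b f + restrict a b g := by
  ext k; simp only [restrict_apply, Finsupp.add_apply]; split_ifs <;> simp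

theorem restrict_sum {ι : Type*} (a b : ℕ+) (s : Finset ι) (g : ι → C00) :
    restrict a b (∑ i ∈ s, g i) = ∑ i ∈ s, restrict a b (g i) :=
  Finsupp.filter_sum s g

theorem restrict_restrict (a b c d : ℕ+) (f : C00) :
    restrict a b (restrict c d f) = restrict (max a c) (min b d) f := by
  ext k
  simp only [restrict_apply, max_le_iff, le_min_iff]
  split_ifs <;> first | rfl | (exfalso; tauto)

theorem exists_support_le (f : C00) : ∃ b : ℕ+, ∀ k ∈ f.support, k ≤ b := by
  obtain ⟨b, hb⟩ := f.support.bddAbove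
  exact ⟨b, fun k hk => hb hk⟩

theorem restrict_eq_self {b : ℕ+} {f : C00} (hb : ∀ k ∈ f.support, k ≤ b) :
    restrict 1 b f = f := by
  ext k
  rw [restrict_apply]
  split_ifs with h
  · rfl
  · by_contra hk
    exact h ⟨one_le, hb k (Finsupp.mem_support_iff.2 (Ne.symm hk))⟩

theorem restrict_eq_zero {a b : ℕ+} (h : b < a) (f : C00) : restrict a b f = 0 := by
  ext k
  rw [restrict_apply, if_neg]
  · rfl
  · rintro ⟨h1, h2⟩
    exact absurd (h1.trans h2) (not_le.2 h)

theorem support_restrict_subset (a b : ℕ+) (f : C00) : (restrict a b f).support ⊆ f.support := by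
  intro k hk
  rw [Finsupp.mem_support_iff, restrict_apply] at hk
  exact Finsupp.mem_support_iff.2 fun h => hk (by simp [h])

theorem Before.mono {f g f' g' : C00} (h : Before f g) (hf : f'.support ⊆ f.support)
    (hg : g'.support ⊆ g.support) : Before f' g' :=
  fun a ha b hb => h a (hf ha) b (hg hb)

theorem Successive.restrict {k : ℕ} {g : Fin k → C00} (h : Successive g) (a b : ℕ+) :
    Successive fun i => restrict a b (g i) :=
  fun i j hij => (h i j hij).mono (support_restrict_subset _ _ _) (support_restrict_subset _ _ _)

theorem Successive.neg {k : ℕ} {g : Fin k → C00} (h : Successive g) :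
    Successive fun i => -g i := by
  intro i j hij
  exact (h i j hij).mono (by simp) (by simp)

/-! ## Tree analyses -/

section Tree

variable {N : ℕ → ℕ} {W : Set C00}

theorem HasTreeAnalysis.mem {f : C00} (h : HasTreeAnalysis N W f) : f ∈ W := by
  cases h <;> assumption

theorem neg_mem_signedBasis {f : C00} (hf : f ∈ signedBasis) : -f ∈ signedBasis := by
  obtain ⟨n, rfl | rfl⟩ := hf
  · exact ⟨n, Or.inr rfl⟩
  · exact ⟨n, Or.inl (neg_neg _)⟩

theorem restrict_signedBasis {f : C00} (hf : f ∈ signedBasis) (a b : ℕ+) :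
    restrict a b f = f ∨ restrict a b f = 0 := by
  obtain ⟨n, hn⟩ := hf
  have hs : ∀ k, k ≠ n → f k = 0 := by
    intro k hk
    rcases hn with rfl | rfl <;> simp [Ne.symm hk]
  by_cases h : a ≤ n ∧ n ≤ b
  · left
    ext k
    rw [restrict_apply]
    by_cases hk : k = n
    · subst hk; rw [if_pos h]
    · simp [hs k hk]
  · right
    ext k
    rw [restrict_apply]
    by_cases hk : k = n
    · subst hk; rw [if_neg h]; rfl
    · simp [hs k hk]

/-- Trees have no nodes for signs or restrictions, whereas the levels are hulls of vectors ±Ef. Both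
are therefore pushed down to the leaves, here and in `HasTreeAnalysis.restrict`. -/
theorem HasTreeAnalysis.neg (hW : SymmInterval W) {f : C00} (h : HasTreeAnalysis N W f) :
    HasTreeAnalysis N W (-f) := by
  induction h with
  | leaf f hf hb => exact .leaf _ (hW.1 f hf) (neg_mem_signedBasis hb)
  | op f hf j k g hk hkN hg hfg _ ih =>
    exact .op _ (hW.1 f hf) j k (fun i => -g i) hk hkN hg.neg (by simp [hfg]) ih
  | conv f hf k r g hr hr1 hfg _ ih =>
    exact .conv _ (hW.1 f hf) k r (fun i => -g i) hr hr1 (by simp [hfg]) ih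

theorem zero_mem_of_symmInterval (hW : SymmInterval W) (hb : signedBasis ⊆ W) : (0 : C00) ∈ W := by
  have h := hW.2 _ (hb ⟨1, Or.inl rfl⟩) 2 1
  rwa [restrict_eq_zero (by decide)] at h

/-- Zero arises when a leaf is restricted away and from the empty special sequence. It is not a leaf
itself, but it is the midpoint of e₁ and -e₁. -/
theorem hasTreeAnalysis_zero (hW : SymmInterval W) (hb : signedBasis ⊆ W) :
    HasTreeAnalysis N W 0 := by
  have hmem : ∀ i : Fin 2, (![Finsupp.single 1 1, -Finsupp.single 1 1] : Fin 2 → C00) i ∈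
      signedBasis := by
    intro i
    fin_cases i
    · exact ⟨1, Or.inl rfl⟩
    · exact ⟨1, Or.inr rfl⟩
  exact .conv 0 (zero_mem_of_symmInterval hW hb) 2 (fun _ => 1 / 2) _ (fun _ => by norm_num)
    (by norm_num) (by simp [Fin.sum_univ_two]) fun i => .leaf _ (hb (hmem i)) (hmem i)

theorem HasTreeAnalysis.restrict (hW : SymmInterval W) (hb : signedBasis ⊆ W) (a b : ℕ+)
    {f : C00} (h : HasTreeAnalysis N W f) : HasTreeAnalysis N W (restrict a b f) := by
  induction h with
  | leaf f hf hbf =>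
    rcases restrict_signedBasis hbf a b with h | h <;> rw [h]
    · exact .leaf _ hf hbf
    · exact hasTreeAnalysis_zero hW hb
  | op f hf j k g hk hkN hg hfg _ ih =>
    exact .op _ (hW.2 f hf a b) j k _ hk hkN (hg.restrict a b)
      (by rw [hfg, restrict_smul, restrict_sum]) ih
  | conv f hf k r g hr hr1 hfg _ ih =>
    exact .conv _ (hW.2 f hf a b) k r _ hr hr1
      (by rw [hfg, restrict_sum]; simp only [restrict_smul]) ih

theorem HasTreeAnalysis.mem_WmT {f : C00} (h : HasTreeAnalysis N W f) : f ∈ WmT N := by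
  rintro S ⟨hb, hop, -, hconv⟩
  induction h with
  | leaf f _ hf => exact hb hf
  | op f _ j k g hk hkN hg hf _ ih => exact hop j ⟨k, g, hk, hkN, ih, hg, hf⟩
  | conv f _ k r g hr hr1 hf _ ih => exact hconv ⟨k, r, g, hr, hr1, ih, hf⟩

end Tree

/-! ## Rational convex hulls -/

theorem subset_ratConv (S : Set C00) : S ⊆ ratConv S := fun f hf =>
  ⟨1, fun _ => 1, fun _ => f, fun _ => zero_le_one, by simp, fun _ => hf, by simp⟩

theorem ratConvex_ratConv (S : Set C00) : RatConvex (ratConv S) := by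
  rintro f ⟨k, r, g, hr, hr1, hg, rfl⟩
  choose l t u ht ht1 hu hgu using hg
  let e : Fin (∑ i, l i) ≃ Σ i, Fin (l i) := finSigmaFinEquiv.symm
  refine ⟨∑ i, l i, fun a => r (e a).1 * t (e a).1 (e a).2, fun a => u (e a).1 (e a).2,
    fun a => mul_nonneg (hr _) (ht _ _), ?_, fun a => hu _ _, ?_⟩
  · rw [Equiv.sum_comp e (fun p => r p.1 * t p.1 p.2), Fintype.sum_sigma]
    simp only [← Finset.mul_sum, ht1, mul_one, hr1]
  · rw [Equiv.sum_comp e (fun p => ((r p.1 * t p.1 p.2 : ℚ) : ℝ) • u p.1 p.2), Fintype.sum_sigma]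
    refine Finset.sum_congr rfl fun i _ => ?_
    rw [hgu i, Finset.smul_sum]
    refine Finset.sum_congr rfl fun j _ => ?_
    rw [smul_smul]; push_cast; rfl

theorem symmInterval_symmIntervalHull (S : Set C00) : SymmInterval (symmIntervalHull S) := by
  refine ⟨?_, ?_⟩
  · rintro f ⟨k, r, g, hr, hr1, hg, rfl⟩
    refine ⟨k, r, fun i => -g i, hr, hr1, fun i => ?_, by simp⟩
    obtain ⟨f, hf, a, b, h | h⟩ := hg i
    · exact ⟨f, hf, a, b, Or.inr (by simp only [h])⟩
    · exact ⟨f, hf, a, b, Or.inl (by simp only [h, neg_neg])⟩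
  · rintro f ⟨k, r, g, hr, hr1, hg, rfl⟩ c d
    refine ⟨k, r, fun i => restrict c d (g i), hr, hr1, fun i => ?_,
      by rw [restrict_sum]; simp only [restrict_smul]⟩
    obtain ⟨f, hf, a, b, h | h⟩ := hg i
    · exact ⟨f, hf, max c a, min d b, Or.inl (by simp only [h, restrict_restrict])⟩
    · exact ⟨f, hf, max c a, min d b, Or.inr (by simp only [h, restrict_neg, restrict_restrict])⟩

theorem subset_symmIntervalHull (S : Set C00) : S ⊆ symmIntervalHull S := by
  intro f hf
  obtain ⟨b, hb⟩ := exists_support_le f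
  exact subset_ratConv _ ⟨f, hf, 1, b, Or.inl (restrict_eq_self hb).symm⟩

/-! ## The parameters -/

theorem two_le_mSeq (j : ℕ) : 2 ≤ mSeq j := by
  induction j with
  | zero => exact le_rfl
  | succ j ih => exact ih.trans (Nat.le_self_pow (by norm_num) _)

theorem lt_mSeq (j : ℕ) : j < mSeq j := by
  induction j with
  | zero => norm_num [mSeq]
  | succ j ih =>
    have h2 := two_le_mSeq j
    have h : mSeq j * mSeq j ≤ mSeq j ^ 5 := by
      rw [← pow_two]; exact Nat.pow_le_pow_right (by omega) (by norm_num)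
    have : mSeq j * 2 ≤ mSeq j * mSeq j := Nat.mul_le_mul_left _ h2
    change j + 1 < mSeq j ^ 5
    omega

theorem mSeq_strictMono : StrictMono mSeq :=
  strictMono_nat_of_lt_succ fun j => lt_self_pow₀ (two_le_mSeq j) (by norm_num)

theorem nSeq_pos (s : ℕ → ℕ) (j : ℕ) : 1 ≤ nSeq s j := by
  induction j with
  | zero => norm_num [nSeq]
  | succ j ih => exact Nat.one_le_pow _ _ (by omega)

/-- The only growth fact behind reflexivity: `n_j / m_j ≥ m_j`, so an operation of full length on
vectors where a form exceeds ε produces arbitrarily large values. -/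
theorem mSeq_sq_le_nSeq {s : ℕ → ℕ} (hs : ∀ j, mSeq (j + 1) ^ 3 ≤ 2 ^ s j) (j : ℕ) :
    mSeq j ^ 2 ≤ nSeq s j := by
  cases j with
  | zero => norm_num [nSeq, mSeq]
  | succ j =>
    have h1 := nSeq_pos s j
    calc mSeq (j + 1) ^ 2 ≤ mSeq (j + 1) ^ 3 :=
          Nat.pow_le_pow_right (by have := two_le_mSeq (j + 1); omega) (by norm_num)
      _ ≤ 2 ^ s j := hs j
      _ ≤ (12 * nSeq s j) ^ s j := Nat.pow_le_pow_left (by omega) _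

theorem nExt_even (s : ℕ → ℕ) (j : ℕ) : nExt s (2 * j) = nSeq s (2 * j) := by
  simp [nExt]

theorem nExt_odd (s : ℕ → ℕ) (j : ℕ) : nExt s (2 * j + 1) = 2 * nSeq s (2 * j + 1) := by
  simp [nExt]

/-! ## The levels of `W_ex` -/

theorem Wlevel_subset_succ (D : Data) (n : ℕ) : Wlevel D n ⊆ Wlevel D (n + 1) := by
  rw [Wlevel_succ]
  exact fun f hf => subset_symmIntervalHull _ (Or.inl (Or.inr hf))

theorem Wlevel_mono (D : Data) : Monotone (Wlevel D) :=
  monotone_nat_of_le_succ (Wlevel_subset_succ D)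

theorem Wlevel_subset_Wex (D : Data) (n : ℕ) : Wlevel D n ⊆ Wex D := Set.subset_iUnion _ n

theorem signedBasis_subset_Wex (D : Data) : signedBasis ⊆ Wex D := Wlevel_subset_Wex D 0

theorem symmInterval_Wex (D : Data) : SymmInterval (Wex D) := by
  -- Level 0 is not a hull and does not contain 0, so every element is moved to a successor level.
  have key : ∀ f ∈ Wex D, ∃ n, f ∈ Wlevel D (n + 1) := by
    intro f hf
    obtain ⟨n, hn⟩ := Set.mem_iUnion.1 hf
    exact ⟨n, Wlevel_subset_succ D n hn⟩
  refine ⟨fun f hf => ?_, fun f hf a b => ?_⟩ <;> obtain ⟨n, hn⟩ := key f hf <;>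
    refine Wlevel_subset_Wex D (n + 1) ?_ <;> rw [Wlevel_succ] at hn ⊢
  · exact (symmInterval_symmIntervalHull _).1 f hn
  · exact (symmInterval_symmIntervalHull _).2 f hn a b

theorem exists_level_of_forall_mem_Wex (D : Data) {k : ℕ} {g : Fin k → C00}
    (hg : ∀ i, g i ∈ Wex D) : ∃ n, ∀ i, g i ∈ Wlevel D n := by
  choose l hl using fun i => Set.mem_iUnion.1 (hg i)
  exact ⟨Finset.univ.sup l, fun i => Wlevel_mono D (Finset.le_sup (Finset.mem_univ i)) (hl i)⟩

theorem ratConvex_Wex (D : Data) : RatConvex (Wex D) := by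
  rintro f ⟨k, r, g, hr, hr1, hg, rfl⟩
  obtain ⟨n, hn⟩ := exists_level_of_forall_mem_Wex D hg
  refine Wlevel_subset_Wex D (n + 1) ?_
  have hn' := fun i => Wlevel_subset_succ D n (hn i)
  rw [Wlevel_succ] at hn' ⊢
  exact ratConvex_ratConv _ ⟨k, r, g, hr, hr1, hn', rfl⟩

/-! ## The sets `K` -/

theorem hat_injective : Function.Injective hat :=
  Finsupp.mapDomain_injective fun _ _ h => mul_left_cancel h

theorem Kfull_apply {s : ℕ → ℕ} {j : ℕ} {g : C00} (hg : g ∈ Kfull s j) :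
    (∃ k, g k ≠ 0) ∧ ∀ k, g k ≠ 0 → g k = (mSeq (2 * j) : ℝ)⁻¹ := by
  obtain ⟨F, hF, rfl⟩ := hg
  have hval : ∀ k, (((mSeq (2 * j) : ℝ)⁻¹) • ∑ i ∈ F, Finsupp.single i (1 : ℝ) : C00) k =
      if k ∈ F then (mSeq (2 * j) : ℝ)⁻¹ else 0 := by
    intro k
    simp [Finsupp.single_apply]
  have hm : (mSeq (2 * j) : ℝ)⁻¹ ≠ 0 := by
    have := two_le_mSeq (2 * j)
    positivity
  obtain ⟨k, hk⟩ : F.Nonempty := Finset.card_pos.1 (hF ▸ nSeq_pos s (2 * j))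
  refine ⟨⟨k, by rwa [hval, if_pos hk]⟩, fun l hl => ?_⟩
  rw [hval] at hl ⊢
  split_ifs with h
  · rfl
  · rw [if_neg h] at hl
    exact absurd rfl hl

theorem eq_of_mem_Kfull {s : ℕ → ℕ} {i j : ℕ} {g : C00} (hi : g ∈ Kfull s i)
    (hj : g ∈ Kfull s j) : i = j := by
  obtain ⟨⟨k, hk⟩, h⟩ := Kfull_apply hi
  have := (h k hk).symm.trans ((Kfull_apply hj).2 k hk)
  have h2 := mSeq_strictMono.injective (Nat.cast_injective (inv_injective this))
  omega

/-- Disjointness is assumed for a fixed `j` only. Different `j` cannot share a vector either,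
because the common value of its nonzero coordinates determines `m_{2j}`. -/
theorem IsKFamily.eq_of_mem {s : ℕ → ℕ} {K : ℕ → ℕ → Set C00} (hK : IsKFamily s K)
    {k l i j : ℕ} (hk : 1 ≤ k) (hl : 1 ≤ l) {g : C00} (h : g ∈ K k i) (h' : g ∈ K l j) :
    k = l := by
  obtain rfl := eq_of_mem_Kfull (hK.subset k i hk h) (hK.subset l j hl h')
  by_contra hkl
  exact Set.disjoint_left.1 (hK.disjoint k l i hk hl hkl) h h'

theorem opResults_even_subset_Wex {D : Data} (hK : IsKFamily D.s D.K) (j : ℕ) :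
    opResults (Wex D) (nSeq D.s (2 * j)) (2 * j) ⊆ Wex D := by
  rintro f ⟨k, g, hk, hkN, hg, hs, hf⟩
  obtain ⟨n, hn⟩ := exists_level_of_forall_mem_Wex D hg
  have hU : ∀ m, n ≤ m → f ∈ Uset D (Wlevel D m) := fun m hm =>
    Set.mem_iUnion.2 ⟨j, k, g, hk, hkN, fun i => Wlevel_mono D hm (hn i), hs, hf⟩
  have hV : ∀ m, n ≤ m → (∀ i l, m + 1 < l → f ∉ hat '' D.K l i) → f ∈ Wex D := by
    intro m hm h
    refine Wlevel_subset_Wex D (m + 1) ?_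
    rw [Wlevel_succ]
    refine subset_symmIntervalHull _ (Or.inl (Or.inl ⟨hU m hm, ?_⟩))
    simp only [Set.mem_iUnion, not_exists]
    exact h
  by_cases h : ∃ i l, n + 1 < l ∧ f ∈ hat '' D.K l i
  · obtain ⟨i, l, hl, g₁, hg₁, rfl⟩ := h
    -- Level `l` withholds only indices above `l`, and `l` is the only index of this vector. Since
    -- `l - 1 ≥ n`, the summands are still available.
    refine hV (l - 1) (by omega) ?_
    rintro i' l' hl' ⟨g₂, hg₂, he⟩
    rw [hat_injective he] at hg₂
    have := hK.eq_of_mem (by omega) (by omega) hg₁ hg₂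
    omega
  · exact hV n le_rfl fun i l hl hmem => h ⟨i, l, hl, hmem⟩

/-- The elements of `K̂^{2j}` are results of an even operation on unit vectors. -/
theorem exists_op_of_mem_hat_Kfull {s : ℕ → ℕ} {j : ℕ} {g : C00} (hg : g ∈ Kfull s j) :
    ∃ u : Fin (nSeq s (2 * j)) → C00, (∀ i, u i ∈ signedBasis) ∧ Successive u ∧
      hat g = ((mSeq (2 * j) : ℝ)⁻¹) • ∑ i, u i := by
  obtain ⟨F, hF, rfl⟩ := hg
  let e := F.orderIsoOfFin hF
  refine ⟨fun i => Finsupp.single (2 * (e i : ℕ+)) 1, fun i => ⟨_, Or.inl rfl⟩, ?_, ?_⟩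
  · intro i i' hii a ha b hb
    have ha' := Finset.mem_singleton.1 (Finsupp.support_single_subset ha)
    have hb' := Finset.mem_singleton.1 (Finsupp.support_single_subset hb)
    subst ha' hb'
    have h : (e i : ℕ+) < e i' := e.strictMono hii
    gcongr
  · rw [hat, Finsupp.mapDomain_smul, Finsupp.mapDomain_finsetSum]
    congr 1
    simp only [Finsupp.mapDomain_single]
    rw [← Finset.sum_coe_sort F]
    exact (Equiv.sum_comp e.toEquiv (fun i : F => Finsupp.single (2 * (i : ℕ+)) (1 : ℝ))).symm

/-- The partners ĝ in a special sequence are not required to lie in `V`; this is what places them in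
`Wex` with their trees. -/
theorem IsKFamily.hasTreeAnalysis_hat {D : Data} (hK : IsKFamily D.s D.K) {k i : ℕ} (hk : 1 ≤ k)
    {g : C00} (hg : g ∈ D.K k i) : HasTreeAnalysis (nExt D.s) (Wex D) (hat g) := by
  obtain ⟨u, hu, hs, hgu⟩ := exists_op_of_mem_hat_Kfull (hK.subset k i hk hg)
  have hb := signedBasis_subset_Wex D
  exact .op _ (opResults_even_subset_Wex hK i
      ⟨_, u, nSeq_pos _ _, le_rfl, fun l => hb (hu l), hs, hgu⟩)
    (2 * i) _ u (nSeq_pos _ _) (nExt_even _ _).ge hs hgu fun l => .leaf _ (hb (hu l)) (hu l)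

/-! ## Tree analyses of the elements of `W_ex` -/

theorem hasTreeAnalysis_list {N : ℕ → ℕ} {W : Set C00} (hW : SymmInterval W)
    (hb : signedBasis ⊆ W) {j : ℕ} {T : List C00} (hT : T.Pairwise Before)
    (hlen : T.length ≤ N j) (hmem : ((mSeq j : ℝ)⁻¹) • T.sum ∈ W)
    (h : ∀ f ∈ T, HasTreeAnalysis N W f) :
    HasTreeAnalysis N W (((mSeq j : ℝ)⁻¹) • T.sum) := by
  -- An operation node needs at least one successor, so the empty list is treated as the zero
  -- vector.
  rcases Nat.eq_zero_or_pos T.length with h0 | h0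
  · rw [List.length_eq_zero_iff.1 h0, List.sum_nil, smul_zero]
    exact hasTreeAnalysis_zero hW hb
  · refine .op _ hmem j T.length T.get h0 hlen (List.pairwise_iff_get.1 hT) ?_
      fun i => h _ (List.get_mem T i)
    rw [← List.sum_ofFn, List.ofFn_get]

theorem length_flat (P : List (C00 × C00)) : (flat P).length = 2 * P.length := by
  simp [flat, List.length_flatMap, mul_comm]

theorem hasTreeAnalysis_Wex {D : Data} {Ω₂ : Set ℕ} (hD : D.Admissible Ω₂) {f : C00}
    (hf : f ∈ Wex D) : HasTreeAnalysis (nExt D.s) (Wex D) f := by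
  have hsym := symmInterval_Wex D
  have hb := signedBasis_subset_Wex D
  obtain ⟨n, hn⟩ := Set.mem_iUnion.1 hf
  clear hf
  induction n generalizing f with
  | zero => exact .leaf _ (hb hn) hn
  | succ n ih =>
    have hsub := (subset_symmIntervalHull _).trans (Wlevel_succ D n).ge
    rw [Wlevel_succ] at hn
    have hV : ∀ f ∈ Vset D (n + 1) (Wlevel D n), HasTreeAnalysis (nExt D.s) (Wex D) f := by
      rintro f (⟨hU, -⟩ | hW)
      · obtain ⟨j, k, g, hk, hkN, hg, hs, hfg⟩ := Set.mem_iUnion.1 hU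
        exact .op _ (opResults_even_subset_Wex hD.family j
            ⟨k, g, hk, hkN, fun i => Wlevel_subset_Wex D n (hg i), hs, hfg⟩)
          (2 * j) k g hk (hkN.trans (nExt_even _ _).ge) hs hfg fun i => ih (hg i)
      · exact ih hW
    obtain ⟨k, r, g, hr, hr1, hg, rfl⟩ := hn
    have hgt : ∀ i, HasTreeAnalysis (nExt D.s) (Wex D) (g i) := by
      intro i
      obtain ⟨f, hf, a, b, h⟩ := hg i
      suffices hft : HasTreeAnalysis (nExt D.s) (Wex D) f by
        rcases h with h | h <;> rw [h]
        · exact hft.restrict hsym hb a b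
        · exact (hft.restrict hsym hb a b).neg hsym
      have hfW : f ∈ Wex D := Wlevel_subset_Wex D (n + 1) (hsub hf)
      rcases hf with hf | hf
      · exact hV f hf
      · obtain ⟨j, P, G, H, hS, rfl⟩ := Set.mem_iUnion.1 hf
        obtain ⟨hblock, hlen, hsemi, hH, -, -⟩ := hS
        obtain ⟨-, -, hP, hG, -, -⟩ := hsemi
        refine hasTreeAnalysis_list hsym hb hblock.2 ?_ hfW ?_
        -- The length is `2|P| + |G| + |H|`, at most twice `|P| + |G| + |H| ≤ n_{2j+1}`.
        · rw [nExt_odd]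
          simp only [List.length_append, length_flat, List.length_map]
          omega
        · intro q hq
          rw [List.mem_append, List.mem_append] at hq
          rcases hq with (hq | hq) | hq
          · obtain ⟨p, hp, hqp⟩ := List.mem_flatMap.1 hq
            obtain ⟨k, i, hk, hkn, hpV, hρ⟩ := hP.2.2.1 p hp
            rcases List.mem_cons.1 hqp with rfl | hqp
            · exact hV _ hpV.1
            · rw [List.mem_singleton.1 hqp, hρ]
              exact hD.family.hasTreeAnalysis_hat hk (hD.ρ_mem k i hk _ hpV.2.2.2)
          · obtain ⟨g, hg, rfl⟩ := List.mem_map.1 hq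
            obtain ⟨k, i, hk, hkn, hgK⟩ := hG g hg
            exact hD.family.hasTreeAnalysis_hat hk hgK
          · exact hV q (hH q hq)
    exact .conv _ (ratConvex_Wex D ⟨k, r, g, hr, hr1, fun i => (hgt i).mem, rfl⟩) k r g hr hr1 rfl
      hgt

theorem eoComplete_Wex {D : Data} {Ω₂ : Set ℕ} (hD : D.Admissible Ω₂) :
    EOComplete (nExt D.s) (Wex D) where
  subset _ hf := (hasTreeAnalysis_Wex hD hf).mem_WmT
  basis := signedBasis_subset_Wex D
  even_op j := by
    rw [nExt_even]
    exact opResults_even_subset_Wex hD.family j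
  symmInterval := symmInterval_Wex D
  tree _ hf := hasTreeAnalysis_Wex hD hf

/-! ## The pairing -/

theorem act_apply (f x : C00) : act f x = ∑ k ∈ x.support, x k * f k := by
  simp [act, Finsupp.linearCombination_apply, Finsupp.sum]

theorem act_single (f : C00) (n : ℕ+) (c : ℝ) : act f (Finsupp.single n c) = c * f n := by
  simp [act]

theorem act_add_left (f g x : C00) : act (f + g) x = act f x + act g x := by
  simp [act_apply, mul_add, Finset.sum_add_distrib]

theorem act_smul_left (c : ℝ) (f x : C00) : act (c • f) x = c * act f x := by
  simp only [act_apply, Finset.mul_sum, Finsupp.smul_apply, smul_eq_mul]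
  exact Finset.sum_congr rfl fun _ _ => by ring

theorem act_neg_left (f x : C00) : act (-f) x = -act f x := by
  simp [act_apply]

theorem act_sum_left {ι : Type*} (s : Finset ι) (g : ι → C00) (x : C00) :
    act (∑ i ∈ s, g i) x = ∑ i ∈ s, act (g i) x := by
  classical
  induction s using Finset.induction_on with
  | empty => simp [act_apply]
  | insert a s ha ih => rw [Finset.sum_insert ha, Finset.sum_insert ha, act_add_left, ih]

theorem act_single_left (n : ℕ+) (c : ℝ) (x : C00) : act (Finsupp.single n c) x = c * x n := by
  induction x using Finsupp.induction_linear with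
  | zero => simp
  | add x y hx hy => rw [map_add, hx, hy, Finsupp.add_apply, mul_add]
  | single k a =>
    rw [act_single, Finsupp.single_apply, Finsupp.single_apply]
    by_cases h : n = k
    · subst h; simp [mul_comm]
    · simp [h, Ne.symm h]

theorem act_restrict (a b : ℕ+) (f x : C00) : act (restrict a b f) x = act f (restrict a b x) := by
  induction x using Finsupp.induction_linear with
  | zero =>
    have h : restrict a b (0 : C00) = 0 := by ext k; simp [restrict_apply]
    rw [h, map_zero, map_zero]
  | add x y hx hy => rw [restrict_add, map_add, map_add, hx, hy]
  | single k c =>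
    have h : restrict a b (Finsupp.single k c) =
        Finsupp.single k (if a ≤ k ∧ k ≤ b then c else 0) := by
      ext l
      rw [restrict_apply]
      by_cases h : k = l
      · subst h; simp
      · simp [h]
    rw [h, act_single, act_single, restrict_apply]
    split_ifs <;> simp

theorem exists_of_act_ne_zero {f x : C00} (h : act f x ≠ 0) :
    ∃ k, k ∈ f.support ∧ k ∈ x.support := by
  rw [act_apply] at h
  obtain ⟨k, hk, hne⟩ := Finset.exists_ne_zero_of_sum_ne_zero h
  exact ⟨k, Finsupp.mem_support_iff.2 (right_ne_zero_of_mul hne), hk⟩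

theorem abs_act_le (f x : C00) {C : ℝ} (hf : ∀ k, |f k| ≤ C) :
    |act f x| ≤ C * ∑ k ∈ x.support, |x k| := by
  rw [act_apply, Finset.mul_sum]
  refine (Finset.abs_sum_le_sum_abs _ _).trans (Finset.sum_le_sum fun k _ => ?_)
  rw [abs_mul, mul_comm]
  exact mul_le_mul_of_nonneg_right (hf k) (abs_nonneg _)

/-- At each coordinate at most one term of a successive sequence is nonzero. -/
theorem Successive.abs_sum_apply_le {p : ℕ} {g : Fin p → C00} (hg : Successive g) (k : ℕ+) {C : ℝ}
    (hC : 0 ≤ C) (h : ∀ i, |g i k| ≤ C) : |(∑ i, g i) k| ≤ C := by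
  rw [Finsupp.finsetSum_apply]
  by_cases h0 : ∃ i, g i k ≠ 0
  · obtain ⟨i, hi⟩ := h0
    rw [Finset.sum_eq_single i ?_ (by simp)]
    · exact h i
    · intro j _ hj
      by_contra hne
      have hi' := Finsupp.mem_support_iff.2 hi
      have hj' := Finsupp.mem_support_iff.2 hne
      rcases lt_or_gt_of_ne hj with hlt | hlt
      · exact lt_irrefl _ (hg j i hlt k hj' k hi')
      · exact lt_irrefl _ (hg i j hlt k hi' k hj')
  · push Not at h0
    simpa [h0] using hC

/-- Two successive sequences of lengths `p` and `k` interlace in at most `p + k` pairs. -/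
theorem Successive.abs_sum_act_le {p k : ℕ} {g : Fin p → C00} {y : Fin k → C00}
    (hg : Successive g) (hy : Successive y) (h : ∀ i n, |act (g i) (y n)| ≤ 1) :
    |act (∑ i, g i) (∑ n, y n)| ≤ p + k := by
  classical
  let S := (Finset.univ : Finset (Fin p × Fin k)).filter fun q => act (g q.1) (y q.2) ≠ 0
  have hmono : ∀ q ∈ S, ∀ q' ∈ S, q.1 < q'.1 → q.2 ≤ q'.2 := by
    intro q hq q' hq' hlt
    obtain ⟨a, ha, hay⟩ := exists_of_act_ne_zero (Finset.mem_filter.1 hq).2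
    obtain ⟨b, hb, hby⟩ := exists_of_act_ne_zero (Finset.mem_filter.1 hq').2
    by_contra hn
    exact lt_asymm (hg _ _ hlt a ha b hb) (hy _ _ (not_le.1 hn) b hby a hay)
  -- By `hmono` the interacting pairs form a staircase, along which `i + n` is injective.
  have hcard : S.card ≤ p + k := by
    rw [← Finset.card_range (p + k)]
    refine Finset.card_le_card_of_injOn (fun q => (q.1 : ℕ) + q.2)
      (fun q _ => Finset.mem_coe.2 (Finset.mem_range.2 (by
        dsimp only; have := q.1.2; have := q.2.2; omega))) ?_
    intro q hq q' hq' he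
    simp only at he
    rcases lt_trichotomy q.1 q'.1 with hlt | heq | hlt
    · have h1 := Fin.le_def.1 (hmono q hq q' hq' hlt)
      have h2 := Fin.lt_def.1 hlt
      omega
    · have h1 : (q.1 : ℕ) = q'.1 := congrArg _ heq
      exact Prod.ext heq (Fin.ext (by omega))
    · have h1 := Fin.le_def.1 (hmono q' hq' q hq hlt)
      have h2 := Fin.lt_def.1 hlt
      omega
  calc |act (∑ i, g i) (∑ n, y n)| = |∑ q : Fin p × Fin k, act (g q.1) (y q.2)| := by
        rw [act_sum_left, Fintype.sum_prod_type]
        simp only [map_sum]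
    _ = |∑ q ∈ S, act (g q.1) (y q.2)| := by rw [Finset.sum_filter_ne_zero]
    _ ≤ ∑ q ∈ S, |act (g q.1) (y q.2)| := Finset.abs_sum_le_sum_abs _ _
    _ ≤ ∑ _q ∈ S, (1 : ℝ) := Finset.sum_le_sum fun q _ => h _ _
    _ ≤ p + k := by
      rw [Finset.sum_const, nsmul_eq_mul, mul_one]
      exact_mod_cast hcard

/-! ## The norm induced by an EO-complete set -/

section EO

variable {N : ℕ → ℕ} {W : Set C00}

/-- It suffices to estimate a vector on unit vectors and on results of operations. -/
theorem EOComplete.forall_abs_act_le (hW : EOComplete N W) (z : C00) {c : ℝ}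
    (hbasis : ∀ n : ℕ+, |z n| ≤ c)
    (hop : ∀ (j k : ℕ) (g : Fin k → C00), k ≤ N j → Successive g → (∀ i, g i ∈ W) →
      ((mSeq j : ℝ)⁻¹) • ∑ i, g i ∈ W → (∀ i, |act (g i) z| ≤ c) →
        |act (((mSeq j : ℝ)⁻¹) • ∑ i, g i) z| ≤ c) :
    ∀ f ∈ W, |act f z| ≤ c := by
  intro f hf
  have ht := hW.tree f hf
  clear hf
  induction ht with
  | leaf f _ hf =>
    obtain ⟨n, rfl | rfl⟩ := hf
    · simpa [act_single_left] using hbasis n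
    · simpa [act_single_left, act_neg_left] using hbasis n
  | op f hf j k g hk hkN hg hfg sub ih =>
    subst hfg
    exact hop j k g hkN hg (fun i => (sub i).mem) hf ih
  | conv f _ k r g hr hr1 hfg sub ih =>
    subst hfg
    rw [act_sum_left]
    refine (Finset.abs_sum_le_sum_abs _ _).trans ?_
    calc ∑ i, |act ((r i : ℝ) • g i) z| ≤ ∑ i, (r i : ℝ) * c := by
          refine Finset.sum_le_sum fun i _ => ?_
          have hri : (0 : ℝ) ≤ r i := by exact_mod_cast hr i
          rw [act_smul_left, abs_mul, abs_of_nonneg hri]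
          exact mul_le_mul_of_nonneg_left (ih i) hri
      _ = c := by
        rw [← Finset.sum_mul]
        have : ∑ i, (r i : ℝ) = 1 := by exact_mod_cast hr1
        rw [this, one_mul]

theorem mSeq_inv_le_half (j : ℕ) : ((mSeq j : ℝ)⁻¹) ≤ 1 / 2 := by
  have : (2 : ℝ) ≤ mSeq j := by exact_mod_cast two_le_mSeq j
  rw [inv_le_comm₀ (by linarith) (by norm_num)]
  linarith

theorem EOComplete.abs_apply_le_one (hW : EOComplete N W) {f : C00} (hf : f ∈ W) (k : ℕ+) :
    |f k| ≤ 1 := by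
  have := hW.forall_abs_act_le (Finsupp.single k 1) (c := 1) ?_ ?_ f hf
  · simpa [act_single] using this
  · intro n
    by_cases h : k = n
    · subst h; simp
    · simp [h]
  · intro j p g _ hg _ _ ih
    simp only [act_single, one_mul] at ih ⊢
    rw [Finsupp.smul_apply, smul_eq_mul, abs_mul, abs_of_nonneg (by positivity)]
    have h1 := hg.abs_sum_apply_le k zero_le_one ih
    have h2 := mSeq_inv_le_half j
    nlinarith [abs_nonneg ((∑ i, g i) k)]

theorem EOComplete.isLUB_normOf (hW : EOComplete N W) (x : C00) :
    IsLUB ((fun f => act f x) '' W) (normOf W x) := by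
  refine Ex.isLUB_normOf W ⟨_, hW.basis ⟨1, Or.inl rfl⟩⟩ hW.symmInterval.1 (fun x => ?_) x
  refine ⟨1 * ∑ k ∈ x.support, |x k|, ?_⟩
  rintro _ ⟨f, hf, rfl⟩
  exact (le_abs_self _).trans (abs_act_le f x (hW.abs_apply_le_one hf))

theorem EOComplete.abs_act_le_normOf (hW : EOComplete N W) {f : C00} (hf : f ∈ W) (x : C00) :
    |act f x| ≤ normOf W x := by
  refine abs_le'.2 ⟨(hW.isLUB_normOf x).1 ⟨f, hf, rfl⟩, ?_⟩
  rw [← act_neg_left]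
  exact (hW.isLUB_normOf x).1 ⟨-f, hW.symmInterval.1 f hf, rfl⟩

theorem EOComplete.normOf_le (hW : EOComplete N W) {x : C00} {c : ℝ} (h : ∀ f ∈ W, act f x ≤ c) :
    normOf W x ≤ c := by
  refine (hW.isLUB_normOf x).2 ?_
  rintro _ ⟨f, hf, rfl⟩
  exact h f hf

theorem EOComplete.abs_apply_le_normOf (hW : EOComplete N W) (x : C00) (n : ℕ+) :
    |x n| ≤ normOf W x := by
  simpa [act_single_left] using hW.abs_act_le_normOf (hW.basis ⟨n, Or.inl rfl⟩) x

theorem EOComplete.normOf_restrict_le (hW : EOComplete N W) (a b : ℕ+) (x : C00) :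
    normOf W (restrict a b x) ≤ normOf W x :=
  hW.normOf_le fun f hf => by
    rw [← act_restrict]
    exact (le_abs_self _).trans (hW.abs_act_le_normOf (hW.symmInterval.2 f hf a b) x)

/-- A vector and the average of sufficiently many successive vectors of norm at most one that
follow it cannot span `ℓ₁²` with a good constant. -/
theorem EOComplete.normOf_half_add_average_le (hW : EOComplete N W) {x : C00}
    (hx : normOf W x ≤ 1) : ∃ k : ℕ, 1 ≤ k ∧ ∀ y : Fin k → C00, Successive y →
      (∀ i, Before x (y i)) → (∀ i, normOf W (y i) ≤ 1) →
      normOf W ((1 / 2 : ℝ) • (x + ((k : ℝ)⁻¹) • ∑ i, y i)) ≤ 7 / 8 := by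
  set S := ∑ k ∈ x.support, |x k| with hS
  -- The threshold between small and large weights: `j ≥ J` forces `m_j ≥ 4‖x‖₁`. The length taken
  -- next exceeds `4 N_j` for every `j < J`.
  set J := ⌈4 * S⌉₊
  refine ⟨1 + 4 * ∑ j ∈ Finset.range J, N j, by omega, fun y hy hxy hy1 => ?_⟩
  have hk : ∀ j < J, 4 * N j ≤ 1 + 4 * ∑ j ∈ Finset.range J, N j := fun j hj => by
    have := Finset.single_le_sum (f := N) (fun _ _ => Nat.zero_le _) (Finset.mem_range.2 hj)
    omega
  have hk1 : 1 ≤ 1 + 4 * ∑ j ∈ Finset.range J, N j := by omega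
  generalize 1 + 4 * ∑ j ∈ Finset.range J, N j = k at *
  have hk0 : (0 : ℝ) < k := by exact_mod_cast hk1
  set v := ((k : ℝ)⁻¹) • ∑ i, y i with hv
  have hv1 : normOf W v ≤ 1 := by
    have hsum : normOf W (∑ i, y i) ≤ k := by
      refine (Finset.le_sum_of_subadditive (normOf W) (map_zero _).le (map_add_le_add _) Finset.univ
        y).trans ?_
      simpa using Finset.sum_le_sum fun i (_ : i ∈ Finset.univ) => hy1 i
    rw [hv, map_smul_eq_mul, Real.norm_of_nonneg (by positivity), inv_mul_le_iff₀ hk0, mul_one]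
    exact hsum
  have hact : ∀ f, act f ((1 / 2 : ℝ) • (x + v)) = (act f x + act f v) / 2 := fun f => by
    rw [map_smul, map_add, smul_eq_mul]; ring
  have htri : ∀ a b : ℝ, |(a + b) / 2| ≤ (|a| + |b|) / 2 := fun a b => by
    rw [abs_div, abs_two]
    have := abs_add_le a b
    linarith
  refine hW.normOf_le fun f hf => (le_abs_self _).trans (hW.forall_abs_act_le _ ?_ ?_ f hf)
  -- The supports of `x` and `v` are disjoint, so one of the two coordinates vanishes and the bound
  -- is 1/2.
  · intro n
    have e : ((1 / 2 : ℝ) • (x + v)) n = (x n + v n) / 2 := by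
      simp only [Finsupp.smul_apply, Finsupp.add_apply, smul_eq_mul]; ring
    rw [e]
    refine (htri _ _).trans ?_
    have hxn := (hW.abs_apply_le_normOf x n).trans hx
    have hvn := (hW.abs_apply_le_normOf v n).trans hv1
    by_cases hn : x n = 0
    · rw [hn, abs_zero]; linarith
    · have : v n = 0 := by
        rw [hv, Finsupp.smul_apply, Finsupp.finsetSum_apply, Finset.sum_eq_zero, smul_zero]
        intro i _
        by_contra hne
        exact lt_irrefl _
          (hxy i n (Finsupp.mem_support_iff.2 hn) n (Finsupp.mem_support_iff.2 hne))
      rw [this, abs_zero]; linarith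
  · intro j p g hp hg hgW hfW _
    have hm0 : (0 : ℝ) ≤ (mSeq j : ℝ)⁻¹ := by positivity
    have hmh := mSeq_inv_le_half j
    have hpair := hg.abs_sum_act_le hy fun i n =>
      (hW.abs_act_le_normOf (hgW i) (y n)).trans (hy1 n)
    rw [hact]
    refine (htri _ _).trans ?_
    -- Small weight: `|f(v)| ≤ (1/2)(p + k)/k ≤ 5/8`, giving `(1 + 5/8)/2 = 13/16`. Large weight:
    -- `|f(x)| ≤ ‖x‖₁/m_j ≤ 1/4`, giving 5/8. Both are below 7/8.
    by_cases hj : j < J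
    · have h1 : |act (((mSeq j : ℝ)⁻¹) • ∑ i, g i) v| ≤ 1 / 2 * (5 / 4) := by
        rw [act_smul_left, abs_mul, abs_of_nonneg hm0]
        refine mul_le_mul hmh ?_ (abs_nonneg _) (by norm_num)
        rw [hv, map_smul, smul_eq_mul, abs_mul, abs_of_nonneg (by positivity),
          inv_mul_le_iff₀ hk0]
        have h4 : 4 * (p : ℝ) ≤ k := by exact_mod_cast (Nat.mul_le_mul_left 4 hp).trans (hk j hj)
        linarith
      have h2 := (hW.abs_act_le_normOf hfW x).trans hx
      linarith
    · have hm : 4 * S ≤ mSeq j := by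
        have h1 : (⌈4 * S⌉₊ : ℝ) ≤ j := by exact_mod_cast not_lt.1 hj
        have h2 : (j : ℝ) ≤ mSeq j := by exact_mod_cast (lt_mSeq j).le
        exact (Nat.le_ceil _).trans (h1.trans h2)
      have hmpos : (0 : ℝ) < mSeq j := by exact_mod_cast (by have := two_le_mSeq j; omega)
      have h1 : |act (((mSeq j : ℝ)⁻¹) • ∑ i, g i) x| ≤ 1 / 4 := by
        rw [act_smul_left, abs_mul, abs_of_nonneg hm0, inv_mul_le_iff₀ hmpos]
        have := abs_act_le (∑ i, g i) x fun k =>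
          hg.abs_sum_apply_le k zero_le_one fun i => hW.abs_apply_le_one (hgW i) k
        linarith
      have h2 := (hW.abs_act_le_normOf hfW v).trans hv1
      linarith

end EO
/-! ## Shrinking and boundedly complete estimates -/

theorem exists_support_le_of_finset (s : Finset C00) :
    ∃ b : ℕ+, ∀ f ∈ s, ∀ k ∈ f.support, k ≤ b := by
  classical
  obtain ⟨b, hb⟩ := (s.biUnion Finsupp.support).bddAbove
  exact ⟨b, fun f hf k hk => hb (Finset.mem_coe.2 (Finset.mem_biUnion.2 ⟨f, hf, hk⟩))⟩

/-- Vectors that can be found beyond every bound form an infinite successive sequence. -/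
theorem exists_seq_before (P : C00 → Prop)
    (h : ∀ M : ℕ+, ∃ x, P x ∧ ∀ k ≤ M, x k = 0) :
    ∃ x : ℕ → C00, (∀ n, P (x n)) ∧ ∀ m n, m < n → Before (x m) (x n) := by
  refine exists_seq_of_forall_finset_exists P Before fun s _ => ?_
  obtain ⟨b, hb⟩ := exists_support_le_of_finset s
  obtain ⟨y, hy, hy0⟩ := h b
  refine ⟨y, hy, fun x hx k hk l hl => (hb x hx k hk).trans_lt ?_⟩
  by_contra hlb
  exact Finsupp.mem_support_iff.1 hl (hy0 l (not_lt.1 hlb))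

section EO

variable {N : ℕ → ℕ} {W : Set C00}

theorem EOComplete.tail_bound_improve (hW : EOComplete N W) (ψ : C00 →ₗ[ℝ] ℝ) {c : ℝ}
    (hc : 0 ≤ c) {M : ℕ+} (h : ∀ x : C00, (∀ k ≤ M, x k = 0) → |ψ x| ≤ c * normOf W x) :
    ∃ M' : ℕ+, ∀ x : C00, (∀ k ≤ M', x k = 0) → |ψ x| ≤ 15 / 16 * c * normOf W x := by
  by_contra! hcon
  have hP : ∀ M' : ℕ+, ∃ x : C00,
      ((∀ k ≤ M, x k = 0) ∧ normOf W x ≤ 1 ∧ 15 / 16 * c < ψ x) ∧ ∀ k ≤ M', x k = 0 := by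
    intro M'
    obtain ⟨x, hx0, hx⟩ := hcon (max M M')
    have hxM : ∀ k ≤ M, x k = 0 := fun k hk => hx0 k (hk.trans (le_max_left _ _))
    have hxc := h x hxM
    have hn : 0 < normOf W x := by
      refine lt_of_le_of_ne (apply_nonneg _ _) fun h0 => ?_
      rw [← h0] at hx hxc
      linarith
    have hkey : 15 / 16 * c < (normOf W x)⁻¹ * |ψ x| := by
      rw [lt_inv_mul_iff₀ hn]; linarith
    obtain ⟨ε, hε, hεψ⟩ : ∃ ε : ℝ, |ε| = 1 ∧ ε * ψ x = |ψ x| := by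
      rcases le_total 0 (ψ x) with h0 | h0
      · exact ⟨1, by simp, by rw [abs_of_nonneg h0, one_mul]⟩
      · exact ⟨-1, by simp, by rw [abs_of_nonpos h0, neg_one_mul]⟩
    refine ⟨((normOf W x)⁻¹ * ε) • x, ⟨fun k hk => by simp [hxM k hk], ?_, ?_⟩,
      fun k hk => by simp [hx0 k (hk.trans (le_max_right _ _))]⟩
    · rw [map_smul_eq_mul, Real.norm_eq_abs, abs_mul, hε, abs_of_pos (inv_pos.2 hn), mul_one,
        inv_mul_cancel₀ hn.ne']
    · rwa [map_smul, smul_eq_mul, mul_assoc, hεψ]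
  obtain ⟨x, hx, hsucc⟩ := exists_seq_before _ hP
  obtain ⟨k, hk, hbound⟩ := hW.normOf_half_add_average_le (hx 0).2.1
  -- `x 0` is the fixed vector, and the average is taken over `x 1, …, x k`.
  have hle := hbound (fun i : Fin k => x (i + 1)) (fun i j hij => hsucc _ _ (by simpa using hij))
    (fun i => hsucc _ _ (Nat.succ_pos _)) fun i => (hx _).2.1
  have hk0 : (0 : ℝ) < k := by exact_mod_cast hk
  set z := (1 / 2 : ℝ) • (x 0 + ((k : ℝ)⁻¹) • ∑ i : Fin k, x (i + 1)) with hz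
  have hzM : ∀ l ≤ M, z l = 0 := by
    intro l hl
    have : ∀ n, x n l = 0 := fun n => (hx n).1 l hl
    simp [hz, this]
  have hzc := (le_abs_self _).trans (h z hzM)
  have hψ : 15 / 16 * c < ψ z := by
    have hsum : (k : ℝ) * (15 / 16 * c) ≤ ∑ i : Fin k, ψ (x (i + 1)) := by
      have := Finset.sum_le_sum fun (i : Fin k) (_ : i ∈ Finset.univ) => (hx (i + 1)).2.2.le
      simpa using this
    have hsum' : 15 / 16 * c ≤ (k : ℝ)⁻¹ * ∑ i : Fin k, ψ (x (i + 1)) := by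
      rwa [le_inv_mul_iff₀ hk0]
    have := (hx 0).2.2
    rw [hz, map_smul, map_add, map_smul, map_sum, smul_eq_mul, smul_eq_mul]
    linarith
  -- The two bounds give `15/16 * c < ψ z ≤ 7/8 * c`, which is impossible for `c ≥ 0`.
  nlinarith

/-- Bounded functionals have small tails: the unit vector basis is shrinking. -/
theorem EOComplete.exists_tail_bound (hW : EOComplete N W) (ψ : C00 →ₗ[ℝ] ℝ) {C : ℝ}
    (hC : 0 ≤ C) (h : ∀ x, |ψ x| ≤ C * normOf W x) {ε : ℝ} (hε : 0 < ε) :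
    ∃ M : ℕ+, ∀ x : C00, (∀ k ≤ M, x k = 0) → |ψ x| ≤ ε * normOf W x := by
  -- Each passage to a further tail gains the factor 15/16.
  have hpow : ∀ n : ℕ, ∃ M : ℕ+, ∀ x : C00, (∀ k ≤ M, x k = 0) →
      |ψ x| ≤ (15 / 16) ^ n * C * normOf W x := by
    intro n
    induction n with
    | zero => exact ⟨1, fun x _ => by simpa using h x⟩
    | succ n ih =>
      obtain ⟨M, hM⟩ := ih
      obtain ⟨M', hM'⟩ := hW.tail_bound_improve ψ (by positivity) hM
      exact ⟨M', fun x hx => (hM' x hx).trans_eq (by ring)⟩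
  have hlim : Filter.Tendsto (fun n : ℕ => (15 / 16 : ℝ) ^ n * C) Filter.atTop (nhds (0 * C)) :=
    (tendsto_pow_atTop_nhds_zero_of_lt_one (by norm_num) (by norm_num)).mul_const C
  rw [zero_mul] at hlim
  obtain ⟨n, hn⟩ := (hlim.eventually (gt_mem_nhds hε)).exists
  obtain ⟨M, hM⟩ := hpow n
  exact ⟨M, fun x hx => (hM x hx).trans
    (mul_le_mul_of_nonneg_right hn.le (apply_nonneg _ _))⟩

/-- Linear forms that are bounded on `W` are small on the elements of `W` with remote support. -/
theorem EOComplete.exists_remote_bound (hW : EOComplete N W)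
    (hN : ∀ j, mSeq (2 * j) ^ 2 ≤ N (2 * j)) (Λ : C00 →ₗ[ℝ] ℝ) {C : ℝ} (h : ∀ f ∈ W, Λ f ≤ C)
    {ε : ℝ} (hε : 0 < ε) :
    ∃ M : ℕ+, ∀ f ∈ W, (∀ k ≤ M, f k = 0) → Λ f ≤ ε := by
  by_contra! hcon
  obtain ⟨f, hf, hsucc⟩ := exists_seq_before (fun f => f ∈ W ∧ ε < Λ f) fun M => by
    obtain ⟨f, hfW, hf0, hf⟩ := hcon M
    exact ⟨f, ⟨hfW, hf⟩, hf0⟩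
  -- With `m = m_{2j} > C/ε`, the operation applied to `N_{2j} ≥ m²` of the vectors has `Λ`-value at
  -- least `mε > C`.
  obtain ⟨j, hj⟩ := exists_nat_gt (C / ε)
  have hm : (j : ℝ) < mSeq (2 * j) := by
    exact_mod_cast (lt_mSeq (2 * j)).trans_le' (by omega)
  have hmpos : (0 : ℝ) < mSeq (2 * j) := (Nat.cast_nonneg j).trans_lt hm
  have hNm : (mSeq (2 * j) : ℝ) * mSeq (2 * j) ≤ N (2 * j) := by
    rw [← pow_two]; exact_mod_cast hN j
  have hN1 : 1 ≤ N (2 * j) := (hN j).trans'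
    (Nat.one_le_pow _ _ (by have := two_le_mSeq (2 * j); omega))
  have hmem : ((mSeq (2 * j) : ℝ)⁻¹) • ∑ i : Fin (N (2 * j)), f i ∈ W :=
    hW.even_op j ⟨N (2 * j), fun i => f i, hN1, le_rfl, fun i => (hf i).1,
      fun i i' hii => hsucc _ _ hii, rfl⟩
  have hC := h _ hmem
  rw [map_smul, map_sum, smul_eq_mul, inv_mul_le_iff₀ hmpos] at hC
  have hsum : (N (2 * j) : ℝ) * ε ≤ ∑ i : Fin (N (2 * j)), Λ (f i) := by
    have := Finset.sum_le_sum fun (i : Fin (N (2 * j))) (_ : i ∈ Finset.univ) => (hf i).2.le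
    simpa using this
  have h1 : C < mSeq (2 * j) * ε := (div_lt_iff₀ hε).1 (hj.trans hm)
  have h2 := mul_le_mul_of_nonneg_right hNm hε.le
  have h3 := mul_lt_mul_of_pos_left h1 hmpos
  nlinarith

end EO

/-! ## The completion -/

/-- The canonical map as a linear map. -/
noncomputable def toSpaceₗ (W : Set C00) : C00 →ₗ[ℝ] Space W where
  toFun := toSpace W
  map_add' x y := UniformSpace.Completion.coe_add (α := Pre W) x y
  map_smul' c x := UniformSpace.Completion.coe_smul (X := Pre W) c x

theorem toSpace_sub (W : Set C00) (x y : C00) : toSpace W (x - y) = toSpace W x - toSpace W y :=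
  map_sub (toSpaceₗ W) x y

theorem denseRange_toSpace (W : Set C00) : DenseRange (toSpace W) :=
  UniformSpace.Completion.denseRange_coe (α := Pre W)

theorem opNorm_le_of_toSpace {W : Set C00} (φ : StrongDual ℝ (Space W)) {C : ℝ} (hC : 0 ≤ C)
    (h : ∀ x, |φ (toSpace W x)| ≤ C * normOf W x) : ‖φ‖ ≤ C := by
  refine φ.opNorm_le_bound hC fun x => ?_
  refine (denseRange_toSpace W).induction_on x
    (isClosed_le (by fun_prop) (by fun_prop)) fun y => ?_
  rw [norm_toSpace]
  exact h y

theorem dual_ext_of_toSpace {W : Set C00} {φ ψ : StrongDual ℝ (Space W)}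
    (h : ∀ x, φ (toSpace W x) = ψ (toSpace W x)) : φ = ψ :=
  ContinuousLinearMap.ext fun x => congrFun
    ((denseRange_toSpace W).equalizer φ.continuous ψ.continuous (funext h)) x

theorem exists_extension {W : Set C00} (ψ : C00 →ₗ[ℝ] ℝ) {C : ℝ}
    (h : ∀ x, |ψ x| ≤ C * normOf W x) :
    ∃ φ : StrongDual ℝ (Space W), ∀ x, φ (toSpace W x) = ψ x := by
  let ψ' : Pre W →L[ℝ] ℝ := LinearMap.mkContinuous (show Pre W →ₗ[ℝ] ℝ from ψ) C h
  refine ⟨ψ'.extend (UniformSpace.Completion.toComplL (𝕜 := ℝ) (E := Pre W)), fun x => ?_⟩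
  exact ContinuousLinearMap.extend_eq ψ' (UniformSpace.Completion.denseRange_coe (α := Pre W))
    (UniformSpace.Completion.isUniformInducing_coe (Pre W)) x

section EO

variable {N : ℕ → ℕ} {W : Set C00}

/-- The functional on `X_W` that extends `x ↦ f(x)`. -/
theorem EOComplete.exists_functional (hW : EOComplete N W) (f : C00) :
    ∃ φ : StrongDual ℝ (Space W), ∀ x, φ (toSpace W x) = act f x := by
  refine exists_extension (C := ∑ k ∈ f.support, |f k|) (act f) fun x => ?_
  have hs : f = ∑ k ∈ f.support, Finsupp.single k (f k) := (Finsupp.sum_single f).symm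
  conv_lhs => rw [hs]
  rw [act_sum_left, Finset.sum_mul]
  refine (Finset.abs_sum_le_sum_abs _ _).trans (Finset.sum_le_sum fun k _ => ?_)
  rw [act_single_left, abs_mul]
  exact mul_le_mul_of_nonneg_left (hW.abs_apply_le_normOf x k) (abs_nonneg _)

/-- The embedding of `c₀₀(ℕ)` into the dual of `X_W`. -/
noncomputable def EOComplete.toDual (hW : EOComplete N W) : C00 →ₗ[ℝ] StrongDual ℝ (Space W) where
  toFun f := (hW.exists_functional f).choose
  map_add' f g := dual_ext_of_toSpace fun x => by
    rw [_root_.add_apply, (hW.exists_functional (f + g)).choose_spec,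
      (hW.exists_functional f).choose_spec, (hW.exists_functional g).choose_spec, act_add_left]
  map_smul' c f := dual_ext_of_toSpace fun x => by
    rw [RingHom.id_apply, _root_.smul_apply,
      (hW.exists_functional (c • f)).choose_spec, (hW.exists_functional f).choose_spec,
      act_smul_left, smul_eq_mul]

theorem EOComplete.toDual_toSpace (hW : EOComplete N W) (f x : C00) :
    hW.toDual f (toSpace W x) = act f x :=
  (hW.exists_functional f).choose_spec x

theorem EOComplete.norm_toDual_le_one (hW : EOComplete N W) {f : C00} (hf : f ∈ W) :
    ‖hW.toDual f‖ ≤ 1 :=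
  opNorm_le_of_toSpace _ zero_le_one fun x => by
    rw [hW.toDual_toSpace, one_mul]
    exact hW.abs_act_le_normOf hf x

theorem EOComplete.asFunctionals_eq (hW : EOComplete N W) :
    asFunctionals W = hW.toDual '' W := by
  ext φ
  constructor
  · rintro ⟨f, hf, h⟩
    exact ⟨f, hf, dual_ext_of_toSpace fun x => by rw [hW.toDual_toSpace, h]⟩
  · rintro ⟨f, hf, rfl⟩
    exact ⟨f, hf, hW.toDual_toSpace f⟩

/-- As the basis is shrinking, `c₀₀(ℕ)` is dense in the dual. -/
theorem EOComplete.denseRange_toDual (hW : EOComplete N W) : DenseRange hW.toDual := by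
  intro φ
  refine Metric.mem_closure_range_iff.2 fun ε hε => ?_
  have hφ : ∀ x, |φ (toSpace W x)| ≤ ‖φ‖ * normOf W x := fun x => by
    rw [← norm_toSpace]; exact φ.le_opNorm _
  obtain ⟨M, hM⟩ := hW.exists_tail_bound ((φ : Space W →ₗ[ℝ] ℝ) ∘ₗ toSpaceₗ W) (norm_nonneg φ) hφ
    (half_pos hε)
  -- The truncation of `φ` to its first `M` coefficients; the difference is `φ` composed with the
  -- tail projection.
  let f : C00 := ∑ k ∈ Finset.Icc 1 M, Finsupp.single k (φ (toSpace W (Finsupp.single k 1)))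
  refine ⟨f, ?_⟩
  rw [dist_eq_norm]
  refine (opNorm_le_of_toSpace _ (half_pos hε).le fun x => ?_).trans_lt (half_lt_self hε)
  obtain ⟨b, hb⟩ := exists_support_le x
  have hf : act f x = φ (toSpace W (restrict 1 M x)) := by
    have hr : restrict 1 M x = ∑ k ∈ Finset.Icc 1 M, x k • Finsupp.single k (1 : ℝ) := by
      ext l
      rw [restrict_apply]
      simp [Finsupp.single_apply]
    have : φ (toSpace W (restrict 1 M x)) =
        ((φ : Space W →ₗ[ℝ] ℝ) ∘ₗ toSpaceₗ W) (restrict 1 M x) := rfl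
    rw [this, hr, map_sum, act_sum_left]
    refine Finset.sum_congr rfl fun k _ => ?_
    rw [map_smul, act_single_left, smul_eq_mul, mul_comm]
    rfl
  have hsplit : x - restrict 1 M x = restrict (M + 1) b x := by
    ext k
    rw [Finsupp.sub_apply, restrict_apply, restrict_apply]
    by_cases hk : k ≤ M
    · rw [if_pos ⟨one_le, hk⟩, if_neg, sub_self]
      exact fun h => absurd (PNat.add_one_le_iff.1 h.1) (not_lt.2 hk)
    · rw [if_neg fun h => hk h.2, sub_zero]
      by_cases hx : x k = 0
      · simp [hx]
      · rw [if_pos ⟨PNat.add_one_le_iff.2 (not_le.1 hk), hb k (Finsupp.mem_support_iff.2 hx)⟩]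
  rw [_root_.sub_apply, hW.toDual_toSpace, hf, ← map_sub, ← toSpace_sub, hsplit]
  refine (hM _ fun k hk => ?_).trans
    (mul_le_mul_of_nonneg_left (hW.normOf_restrict_le _ _ x) (half_pos hε).le)
  rw [restrict_apply, if_neg]
  exact fun h => absurd (PNat.add_one_le_iff.1 h.1) (not_lt.2 hk)

/-- EO-complete sets with enough even operations norm reflexive spaces. -/
theorem EOComplete.reflexive (hW : EOComplete N W)
    (hN : ∀ j, mSeq (2 * j) ^ 2 ≤ N (2 * j)) : Reflexive (Space W) := by
  intro F
  let Λ : C00 →ₗ[ℝ] ℝ := (F : StrongDual ℝ (Space W) →ₗ[ℝ] ℝ) ∘ₗ hW.toDual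
  have hΛ : ∀ f ∈ W, Λ f ≤ ‖F‖ := fun f hf => by
    refine (le_abs_self _).trans ((F.le_opNorm _).trans ?_)
    exact mul_le_of_le_one_right (norm_nonneg F) (hW.norm_toDual_le_one hf)
  -- Partial sums of the candidate preimage of `F`: its k-th coordinate must be `F` of the k-th
  -- coordinate functional.
  let s : ℕ+ → C00 := fun n => ∑ k ∈ Finset.Icc 1 n, Finsupp.single k (Λ (Finsupp.single k 1))
  have hs_act : ∀ f n, act f (s n) = Λ (restrict 1 n f) := by
    intro f n
    have hr : restrict 1 n f = ∑ k ∈ Finset.Icc 1 n, f k • Finsupp.single k (1 : ℝ) := by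
      ext l
      rw [restrict_apply]
      simp [Finsupp.single_apply]
    rw [hr, map_sum, map_sum]
    refine Finset.sum_congr rfl fun k _ => ?_
    rw [act_single, map_smul, smul_eq_mul, mul_comm]
  -- An `f ∈ W` maps `s n - s M` to `Λ` of the restriction of `f` to `(M, n]`, a remote element of
  -- `W`. The estimate is uniform in `f`.
  have hcauchy : CauchySeq fun n => toSpace W (s n) := by
    rw [Metric.cauchySeq_iff']
    intro ε hε
    obtain ⟨M, hM⟩ := hW.exists_remote_bound hN Λ hΛ (half_pos hε)
    refine ⟨M, fun n hn => ?_⟩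
    rw [dist_eq_norm, ← toSpace_sub, norm_toSpace]
    refine (hW.normOf_le fun f hf => ?_).trans_lt (half_lt_self hε)
    have hdiff : restrict 1 n f - restrict 1 M f = restrict (M + 1) n f := by
      ext k
      rw [Finsupp.sub_apply, restrict_apply, restrict_apply, restrict_apply]
      by_cases hk : k ≤ M
      · rw [if_pos ⟨one_le, hk.trans hn⟩, if_pos ⟨one_le, hk⟩, if_neg, sub_self]
        exact fun h => absurd (PNat.add_one_le_iff.1 h.1) (not_lt.2 hk)
      · have h1 := PNat.add_one_le_iff.2 (not_le.1 hk)
        rw [if_neg (fun h => hk h.2 : ¬(1 ≤ k ∧ k ≤ M)), sub_zero]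
        simp [h1]
    rw [map_sub, hs_act, hs_act, ← map_sub, hdiff]
    refine hM _ (hW.symmInterval.2 f hf _ _) fun k hk => ?_
    rw [restrict_apply, if_neg]
    exact fun h => absurd (PNat.add_one_le_iff.1 h.1) (not_lt.2 hk)
  obtain ⟨x, hx⟩ := cauchySeq_tendsto_of_complete hcauchy
  refine ⟨x, ContinuousLinearMap.ext fun φ => ?_⟩
  rw [NormedSpace.dual_def]
  -- By density only finitely supported functionals need checking, and on these the values along `s
  -- n` are eventually constant.
  refine hW.denseRange_toDual.induction_on φ (isClosed_eq (by fun_prop) (by fun_prop)) fun f => ?_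
  obtain ⟨b, hb⟩ := exists_support_le f
  have hconst : ∀ᶠ n in Filter.atTop, hW.toDual f (toSpace W (s n)) = Λ f := by
    filter_upwards [Filter.eventually_ge_atTop b] with n hn
    rw [hW.toDual_toSpace, hs_act, restrict_eq_self fun k hk => (hb k hk).trans hn]
  exact tendsto_nhds_unique (((hW.toDual f).continuous.tendsto x).comp hx)
    (tendsto_const_nhds.congr' (hconst.mono fun _ h => h.symm))

/-! ### The dual unit ball -/

theorem EOComplete.convex_closure_asFunctionals (hW : EOComplete N W) (hQ : RatConvex W) :
    Convex ℝ (closure (asFunctionals W)) := by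
  have hseg : ∀ φ ∈ asFunctionals W, ∀ ψ ∈ asFunctionals W, ∀ a ∈ Set.Ioo (0 : ℝ) 1,
      a • φ + (1 - a) • ψ ∈ closure (asFunctionals W) := by
    rw [hW.asFunctionals_eq]
    rintro _ ⟨f, hf, rfl⟩ _ ⟨g, hg, rfl⟩ a ha
    -- Only rational coefficients stay in `W`; they are dense in the open interval, and the closure
    -- supplies the real ones.
    have hmem := (Rat.denseRange_cast (𝕜 := ℝ)).open_subset_closure_inter isOpen_Ioo ha
    have hmaps : Set.MapsTo (fun t : ℝ => t • hW.toDual f + (1 - t) • hW.toDual g)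
        (Set.Ioo 0 1 ∩ Set.range ((↑) : ℚ → ℝ)) (hW.toDual '' W) := by
      rintro _ ⟨⟨h0, h1⟩, q, rfl⟩
      have hq0 : 0 ≤ q := by exact_mod_cast h0.le
      have hq1 : 0 ≤ 1 - q := by
        have : q ≤ 1 := by exact_mod_cast h1.le
        linarith
      refine ⟨(q : ℝ) • f + (1 - q : ℝ) • g, hQ ⟨2, ![q, 1 - q], ![f, g], ?_, ?_, ?_, ?_⟩, ?_⟩
      · exact Fin.forall_fin_two.2 ⟨hq0, hq1⟩
      · simp
      · intro i; fin_cases i <;> simpa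
      · simp [Fin.sum_univ_two]
      · simp only [map_add, map_smul]
    have hcont : Continuous fun t : ℝ => t • hW.toDual f + (1 - t) • hW.toDual g := by fun_prop
    have hcl := map_mem_closure hcont hmem hmaps
    exact hcl
  intro φ hφ ψ hψ a b ha hb hab
  obtain rfl : b = 1 - a := by linarith
  rcases ha.eq_or_lt with rfl | ha
  · simpa using hψ
  rcases hb.eq_or_lt with hb | hb
  · obtain rfl : a = 1 := by linarith
    simpa using hφ
  have := map_mem_closure₂ (f := fun φ ψ : StrongDual ℝ (Space W) => a • φ + (1 - a) • ψ)
    (by fun_prop) hφ hψ (fun φ hφ ψ hψ => hseg φ hφ ψ hψ a ⟨ha, by linarith⟩)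
  rwa [closure_closure] at this

/-- The unit ball of the dual is the norm closure of the norming set. -/
theorem EOComplete.closedBall_eq_closure (hW : EOComplete N W) (hQ : RatConvex W)
    (hN : ∀ j, mSeq (2 * j) ^ 2 ≤ N (2 * j)) :
    Metric.closedBall (0 : StrongDual ℝ (Space W)) 1 = closure (asFunctionals W) := by
  refine Set.Subset.antisymm (fun φ hφ => ?_) (closure_minimal ?_ Metric.isClosed_closedBall)
  · by_contra hcl
    obtain ⟨F, u, hF, hu⟩ := geometric_hahn_banach_closed_point
      (hW.convex_closure_asFunctionals hQ) isClosed_closure hcl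
    -- Reflexivity turns norm separation in the dual into separation by a point of the space.
    obtain ⟨x, rfl⟩ := hW.reflexive hN F
    simp only [NormedSpace.dual_def] at hF hu
    have hφ1 : ‖φ‖ ≤ 1 := by simpa using hφ
    have hφx : φ x ≤ ‖x‖ := (le_abs_self _).trans
      ((φ.le_opNorm x).trans (mul_le_of_le_one_left (norm_nonneg x) hφ1))
    -- Three errors of this size occur: `f` nearly norms `y`, and replacing `x` by `y` costs once in
    -- `f` and once in the norm. A quarter of the gap leaves room for them.
    have hδ : 0 < (φ x - u) / 4 := by linarith
    obtain ⟨y, hy⟩ := (denseRange_toSpace W).exists_dist_lt x hδ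
    rw [dist_eq_norm] at hy
    obtain ⟨_, ⟨f, hf, rfl⟩, hfy⟩ : ∃ r ∈ (fun f => act f y) '' W,
        normOf W y - (φ x - u) / 4 < r := by
      by_contra! hcon
      have := (hW.isLUB_normOf y).2 hcon
      linarith
    have hfu := hF (hW.toDual f) (subset_closure (hW.asFunctionals_eq ▸ ⟨f, hf, rfl⟩))
    have hfxy : |hW.toDual f (x - toSpace W y)| ≤ ‖x - toSpace W y‖ :=
      ((hW.toDual f).le_opNorm _).trans
        (mul_le_of_le_one_left (norm_nonneg _) (hW.norm_toDual_le_one hf))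
    rw [map_sub, hW.toDual_toSpace] at hfxy
    have hfxy' := (abs_le.1 hfxy).1
    have hnorm := norm_sub_norm_le x (toSpace W y)
    rw [norm_toSpace] at hnorm
    dsimp only at hfy
    linarith
  · rw [hW.asFunctionals_eq]
    rintro _ ⟨f, hf, rfl⟩
    simpa using hW.norm_toDual_le_one hf

end EO

end Ex

/-! ### Application to `Wex` -/

theorem mainTheorem9 (D : Ex.Data) (Ω₂ : Set ℕ) (hD : D.Admissible Ω₂) :
    Ex.EOComplete (Ex.nExt D.s) (Ex.Wex D) ∧ Ex.RatConvex (Ex.Wex D) ∧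
    (∀ x : C00, IsLUB ((fun f => Ex.act f x) '' Ex.Wex D) ‖Ex.toSpace (Ex.Wex D) x‖) ∧
    Ex.Reflexive (Ex.Space (Ex.Wex D)) ∧
    Metric.closedBall (0 : StrongDual ℝ (Ex.Space (Ex.Wex D))) 1 =
      closure (Ex.asFunctionals (Ex.Wex D)) := by
  have hW := Ex.eoComplete_Wex hD
  have hQ := Ex.ratConvex_Wex D
  have hN : ∀ j, Ex.mSeq (2 * j) ^ 2 ≤ Ex.nExt D.s (2 * j) := fun j =>
    (Ex.mSeq_sq_le_nSeq hD.s_large _).trans (Ex.nExt_even D.s j).ge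
  exact ⟨hW, hQ, fun x => by rw [Ex.norm_toSpace]; exact hW.isLUB_normOf x, hW.reflexive hN,
    hW.closedBall_eq_closure hQ hN⟩
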